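/- All manifolds, maps, submanifolds and forms are smooth; submanifolds are embedded; manifolds are Hausdorff and second countable. Write $dx_{ijkl}=dx_i\wedge dx_j\wedge dx_k\wedge dx_l$ and let $$\Phi_0=dx_{1234}+dx_{1256}-dx_{1278}+dx_{1357}+dx_{1368}+dx_{1458}-dx_{1467}-dx_{2358}+dx_{2367}+dx_{2457}+dx_{2468}-dx_{3456}+dx_{3478}+dx_{5678}$$ on $\mathbb R^8$. A $\mathrm{Spin}(7)$-structure on an $8$-manifold $M$ is a $4$-form $\Phi$ on $M$ such that for every $x\in M$ there is a linear isomorphism $i_x\colon T_xM\to\mathbb R^8$ with $i_x^*\Phi_0=\Phi_x$. It induces a Riemannian metric $g=g(\Phi)$ on $M$, the pullback of the Euclidean metric under the $i_x$ (which does not depend on the choice of the $i_x$). It is called torsion-free if $\nabla\Phi=0$ for the Levi-Civita connection $\nabla$ of $g$. An oriented $4$-dimensional submanifold $X$ of $M$ (possibly with boundary) is called Cayley if $\Phi|_X=\mathrm{vol}_X$, where $\mathrm{vol}_X$ is the volume form of the metric induced by $g$ and of the given orientation of $X$. Volumes of submanifolds are taken with respect to $g$. Let $M$ be an $8$-manifold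 with a torsion-free $\mathrm{Spin}(7)$-structure $\Phi$. Let $W$ be a $4$-dimensional submanifold of $M$ (without boundary) with $\Phi|_W=0$. Let $X$ be a compact Cayley submanifold of $M$, with (possibly empty) boundary $\partial X\subseteq W$, oriented by $\Phi|_X=\mathrm{vol}_X$. Let $Y$ be a compact oriented $4$-dimensional submanifold of $M$ with (possibly empty) boundary $\partial Y\subseteq W$ such that $X$ and $Y$ represent the same class in the relative homology group $H_4(M,W;\mathbb Z)$ (smooth singular homology). Then $$\mathrm{vol}(Y)\ \ge\ \mathrm{vol}(X),$$ and equality holds if and only if $Y$ is Cayley, i.e. $\Phi|_Y=\mathrm{vol}_Y$ for the given orientation of $Y$. -/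

import Mathlib

open Set Topology MeasureTheory Module
open scoped Manifold ContDiff ENNReal

noncomputable section

namespace CayleyGeometry

/-! ### The standard Cayley form on `ℝ⁸` -/

/-- The `4`-form `dx_{s 0} ∧ dx_{s 1} ∧ dx_{s 2} ∧ dx_{s 3}` on `ℝ⁸`
(coordinates are numbered `0, …, 7`). -/
def dx (s : Fin 4 → Fin 8) : EuclideanSpace ℝ (Fin 8) [⋀^Fin 4]→L[ℝ] ℝ :=
  { (Matrix.detRowAlternating (n := Fin 4) (R := ℝ)).compLinearMap
      (LinearMap.pi fun k => (EuclideanSpace.proj (𝕜 := ℝ) (s k)).toLinearMap) with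
    cont := by
      change Continuous fun v : Fin 4 → EuclideanSpace ℝ (Fin 8) =>
        Matrix.det (fun a b => v a (s b))
      exact Continuous.matrix_det (by fun_prop) }

theorem dx_apply (s : Fin 4 → Fin 8) (v : Fin 4 → EuclideanSpace ℝ (Fin 8)) :
    dx s v = Matrix.det (Matrix.of fun a b => v a (s b)) := rfl

/-- The form `Φ₀` on `ℝ⁸`, whose stabiliser in `GL(8, ℝ)` is `Spin(7) ⊆ SO(8)`. -/
def cayleyForm₀ : EuclideanSpace ℝ (Fin 8) [⋀^Fin 4]→L[ℝ] ℝ :=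
  dx ![0, 1, 2, 3] + dx ![0, 1, 4, 5] - dx ![0, 1, 6, 7] + dx ![0, 2, 4, 6]
    + dx ![0, 2, 5, 7] + dx ![0, 3, 4, 7] - dx ![0, 3, 5, 6] - dx ![1, 2, 4, 7]
    + dx ![1, 2, 5, 6] + dx ![1, 3, 4, 6] + dx ![1, 3, 5, 7] - dx ![2, 3, 4, 5]
    + dx ![2, 3, 6, 7] + dx ![4, 5, 6, 7]

/-! ### `Spin(7)`-structures, their metric, and the torsion-free condition -/

section Spin7

variable {M : Type*} [TopologicalSpace M] [ChartedSpace (EuclideanSpace ℝ (Fin 8)) M]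

/-- The expression of a `4`-form on `M` in the chart around `x₀`, i.e. its pullback under the
inverse of this chart. -/
def formInChart (φ : ∀ x : M, TangentSpace (𝓡 8) x [⋀^Fin 4]→L[ℝ] ℝ) (x₀ : M)
    (u : EuclideanSpace ℝ (Fin 8)) : EuclideanSpace ℝ (Fin 8) [⋀^Fin 4]→L[ℝ] ℝ :=
  (φ ((extChartAt (𝓡 8) x₀).symm u)).compContinuousLinearMap
    (mfderiv 𝓘(ℝ, EuclideanSpace ℝ (Fin 8)) (𝓡 8) (extChartAt (𝓡 8) x₀).symm u)

variable (M) in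
/-- A `Spin(7)`-structure on an `8`-manifold, given by a smooth `4`-form which at every point is
identified with `Φ₀` by some linear isomorphism `T_x M ≃ ℝ⁸`. -/
structure Spin7Structure where
  /-- The `4`-form `Φ`. -/
  form : ∀ x : M, TangentSpace (𝓡 8) x [⋀^Fin 4]→L[ℝ] ℝ
  smooth : ∀ x₀ : M, ContDiffOn ℝ ∞ (formInChart form x₀) (extChartAt (𝓡 8) x₀).target
  exists_iso : ∀ x : M, ∃ i : TangentSpace (𝓡 8) x ≃L[ℝ] EuclideanSpace ℝ (Fin 8),
    cayleyForm₀.compContinuousLinearMap (i : TangentSpace (𝓡 8) x →L[ℝ] _) = form x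

namespace Spin7Structure

variable (Φ : Spin7Structure M)

/-- An isomorphism `T_x M ≃ ℝ⁸` identifying `Φ_x` with `Φ₀`. -/
def frame (x : M) : TangentSpace (𝓡 8) x ≃L[ℝ] EuclideanSpace ℝ (Fin 8) :=
  (Φ.exists_iso x).choose

/-- The metric `g = g(Φ)`: the pullback of the Euclidean metric under an isomorphism that
identifies `Φ_x` with `Φ₀` (independent of the choice, because the stabiliser of `Φ₀` consists of
isometries). -/
def metric (x : M) (v w : TangentSpace (𝓡 8) x) : ℝ :=
  inner ℝ (Φ.frame x v) (Φ.frame x w)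

/-- The function `g(a, b)` in the chart around `x₀`, for constant vector fields `a`, `b`. -/
def metricInChart (x₀ : M) (a b u : EuclideanSpace ℝ (Fin 8)) : ℝ :=
  Φ.metric ((extChartAt (𝓡 8) x₀).symm u)
    (mfderiv 𝓘(ℝ, EuclideanSpace ℝ (Fin 8)) (𝓡 8) (extChartAt (𝓡 8) x₀).symm u a)
    (mfderiv 𝓘(ℝ, EuclideanSpace ℝ (Fin 8)) (𝓡 8) (extChartAt (𝓡 8) x₀).symm u b)

/-- `Γ` is the Christoffel symbol at `u`, in the chart around `x₀`, of the Levi-Civita connection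
`∇_v w = D_v w + Γ(v, w)` of `g`: the (unique) bilinear map such that the connection is
torsion-free and compatible with the metric. -/
def IsLeviCivitaAt (x₀ : M) (u : EuclideanSpace ℝ (Fin 8))
    (Γ : EuclideanSpace ℝ (Fin 8) →ₗ[ℝ] EuclideanSpace ℝ (Fin 8) →ₗ[ℝ]
      EuclideanSpace ℝ (Fin 8)) : Prop :=
  (∀ v w, Γ v w = Γ w v) ∧
  ∀ v a b, fderiv ℝ (Φ.metricInChart x₀ a b) u v =
    Φ.metricInChart x₀ (Γ v a) b u + Φ.metricInChart x₀ a (Γ v b) u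

/-- `∇Φ = 0` for the Levi-Civita connection `∇` of `g(Φ)`, where
`(∇_v Φ)(a₁, …, a₄) = D_v (Φ(a₁, …, a₄)) - ∑ₖ Φ(a₁, …, Γ(v, aₖ), …, a₄)` in charts. -/
def IsTorsionFree : Prop :=
  ∀ x₀ : M, ∀ u ∈ (extChartAt (𝓡 8) x₀).target, ∃ Γ, Φ.IsLeviCivitaAt x₀ u Γ ∧
    ∀ (v : EuclideanSpace ℝ (Fin 8)) (a : Fin 4 → EuclideanSpace ℝ (Fin 8)),
      fderiv ℝ (fun u' => formInChart Φ.form x₀ u' a) u v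
        - ∑ k, formInChart Φ.form x₀ u (Function.update a k (Γ v (a k))) = 0

end Spin7Structure

end Spin7

/-! ### Orientations, Cayley submanifolds, volume -/

section Submanifold

/-- An orientation of a `4`-manifold with boundary: a choice of orientation of every tangent space
such that every point has a neighbourhood with a positively oriented continuous frame. -/
structure ManifoldOrientation (X : Type*) [TopologicalSpace X]
    [ChartedSpace (EuclideanHalfSpace 4) X] [IsManifold (𝓡∂ 4) ∞ X] where
  /-- The orientation of the tangent space at a point. -/
  at' : ∀ y : X, Orientation ℝ (TangentSpace (𝓡∂ 4) y) (Fin 4)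
  continuous' : ∀ y₀ : X, ∃ U ∈ 𝓝 y₀, ∃ s : Fin 4 → ∀ y : X, TangentSpace (𝓡∂ 4) y,
    (∀ k, ContinuousOn (fun y => (⟨y, s k y⟩ : TangentBundle (𝓡∂ 4) X)) U) ∧
    ∀ y ∈ U, ∃ b : Basis (Fin 4) ℝ (TangentSpace (𝓡∂ 4) y),
      (∀ k, b k = s k y) ∧ b.orientation = at' y

variable {M : Type*} [TopologicalSpace M] [ChartedSpace (EuclideanSpace ℝ (Fin 8)) M]
  {X : Type*} [TopologicalSpace X] [ChartedSpace (EuclideanHalfSpace 4) X]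

/-- The `4`-dimensional volume `√(det (g(vᵢ, vⱼ)))` of the parallelepiped spanned by four tangent
vectors. -/
def Spin7Structure.gramVolume (Φ : Spin7Structure M) (x : M)
    (v : Fin 4 → TangentSpace (𝓡 8) x) : ℝ :=
  √(Matrix.det (Matrix.of fun i j => Φ.metric x (v i) (v j)))

/-- The submanifold `ι : X → M` with orientation `o` is Cayley: `Φ|_X = vol_X`. Here `vol_X` is the
form whose value on a positively oriented basis is the volume of the spanned parallelepiped. -/
def IsCayley [IsManifold (𝓡∂ 4) ∞ X] (Φ : Spin7Structure M) (ι : X → M)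
    (o : ManifoldOrientation X) : Prop :=
  ∀ (y : X) (b : Basis (Fin 4) ℝ (TangentSpace (𝓡∂ 4) y)), b.orientation = o.at' y →
    Φ.form (ι y) (fun k => mfderiv (𝓡∂ 4) (𝓡 8) ι y (b k)) =
      Φ.gramVolume (ι y) (fun k => mfderiv (𝓡∂ 4) (𝓡 8) ι y (b k))

/-- The density `√(det (g(∂ᵢ, ∂ⱼ)))` of the induced metric in the chart of `X` around `y₀`. -/
def volumeDensity (Φ : Spin7Structure M) (ι : X → M) (y₀ : X)
    (u : EuclideanSpace ℝ (Fin 4)) : ℝ :=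
  Φ.gramVolume (ι ((extChartAt (𝓡∂ 4) y₀).symm u)) fun k =>
    mfderivWithin 𝓘(ℝ, EuclideanSpace ℝ (Fin 4)) (𝓡 8)
      (ι ∘ (extChartAt (𝓡∂ 4) y₀).symm) (range (𝓡∂ 4)) u (EuclideanSpace.single k 1)

/-- The Riemannian measure of the metric that `g(Φ)` induces on `X`. In the domain of each chart it
is `√(det (g(∂ᵢ, ∂ⱼ)))` times Lebesgue measure; these measures agree on overlaps, and the measure
on `X` that they define is their supremum. -/
def volumeMeasure [MeasurableSpace X] [BorelSpace X] (Φ : Spin7Structure M) (ι : X → M) :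
    Measure X :=
  ⨆ y₀ : X, ((volume.restrict (extChartAt (𝓡∂ 4) y₀).target).withDensity
    fun u => ENNReal.ofReal (volumeDensity Φ ι y₀ u)).map (extChartAt (𝓡∂ 4) y₀).symm

/-- The volume of the submanifold `ι : X → M`. -/
def vol (Φ : Spin7Structure M) (ι : X → M) : ℝ≥0∞ :=
  letI : MeasurableSpace X := borel X
  haveI : BorelSpace X := ⟨rfl⟩
  volumeMeasure Φ ι univ

end Submanifold

/-! ### Smooth singular chains and relative homology -/

section Chains

/-- The standard simplex `{a ∈ ℝⁿ | aᵢ ≥ 0, ∑ aᵢ ≤ 1}`, with vertices `0, e₁, …, eₙ`. -/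
def stdCorner (n : ℕ) : Set (Fin n → ℝ) := {a | (∀ i, 0 ≤ a i) ∧ ∑ i, a i ≤ 1}

theorem zero_mem_stdCorner (n : ℕ) : (0 : Fin n → ℝ) ∈ stdCorner n := by
  simp [stdCorner]

/-- The inclusion of the `k`-th face: in barycentric coordinates `(1 - ∑ aᵢ, a₁, …, aₙ)` it inserts
a zero at position `k`. -/
def faceMap {n : ℕ} (k : Fin (n + 2)) (a : Fin n → ℝ) : Fin (n + 1) → ℝ :=
  fun j => (k.insertNth (0 : ℝ) (Fin.cons (1 - ∑ i, a i) a : Fin (n + 1) → ℝ) :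
    Fin (n + 2) → ℝ) j.succ

theorem contDiff_faceMap {n : ℕ} (k : Fin (n + 2)) : ContDiff ℝ ∞ (faceMap (n := n) k) := by
  have h : ∀ j : Fin (n + 2), ContDiff ℝ ∞ fun a : Fin n → ℝ =>
      (k.insertNth (0 : ℝ) (Fin.cons (1 - ∑ i, a i) a : Fin (n + 1) → ℝ) :
        Fin (n + 2) → ℝ) j := by
    intro j
    refine Fin.succAboveCases k ?_ (fun i => ?_) j
    · simpa using contDiff_const
    · simp only [Fin.insertNth_apply_succAbove]
      refine Fin.cases ?_ (fun i => ?_) i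
      · simp only [Fin.cons_zero]
        fun_prop
      · simp only [Fin.cons_succ]
        fun_prop
  exact contDiff_pi.2 fun j => h j.succ

theorem faceMap_mem {n : ℕ} (k : Fin (n + 2)) {a : Fin n → ℝ} (ha : a ∈ stdCorner n) :
    faceMap k a ∈ stdCorner (n + 1) := by
  obtain ⟨h0, h1⟩ := ha
  set b : Fin (n + 1) → ℝ := Fin.cons (1 - ∑ i, a i) a with hb
  have hb0 : ∀ i, 0 ≤ b i := by
    intro i
    refine Fin.cases ?_ (fun i => ?_) i
    · simpa [hb] using h1
    · simpa [hb] using h0 i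
  have hc0 : ∀ j, 0 ≤ (k.insertNth (0 : ℝ) b : Fin (n + 2) → ℝ) j := by
    intro j
    refine Fin.succAboveCases k ?_ (fun i => ?_) j
    · simp
    · simpa using hb0 i
  have hs : ∑ j, (k.insertNth (0 : ℝ) b : Fin (n + 2) → ℝ) j = 1 := by
    rw [Fin.sum_univ_succAbove _ k]
    simp [hb, Fin.sum_univ_succ]
  refine ⟨fun j => hc0 j.succ, ?_⟩
  have := hc0 0
  rw [Fin.sum_univ_succ] at hs
  change ∑ j : Fin (n + 1), (k.insertNth (0 : ℝ) b : Fin (n + 2) → ℝ) j.succ ≤ 1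
  linarith

variable (M : Type*) [TopologicalSpace M] [ChartedSpace (EuclideanSpace ℝ (Fin 8)) M]

/-- Smooth singular `n`-simplices of `M`: maps from the standard simplex to `M` that extend to a
smooth map on a neighbourhood of the simplex in `ℝⁿ`. -/
structure SmoothSimplex (n : ℕ) where
  toFun : stdCorner n → M
  smooth' : ∃ U : Set (Fin n → ℝ), IsOpen U ∧ stdCorner n ⊆ U ∧ ∃ f : (Fin n → ℝ) → M,
    ContMDiffOn 𝓘(ℝ, Fin n → ℝ) (𝓡 8) ∞ f U ∧ ∀ t : stdCorner n, f t = toFun t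

/-- Smooth singular `n`-chains of `M` with integer coefficients. -/
abbrev Chain (n : ℕ) : Type _ := SmoothSimplex M n →₀ ℤ

variable {M}

/-- The `k`-th face of a smooth singular simplex. -/
def SmoothSimplex.face {n : ℕ} (σ : SmoothSimplex M (n + 1)) (k : Fin (n + 2)) :
    SmoothSimplex M n where
  toFun t := σ.toFun ⟨faceMap k t, faceMap_mem k t.2⟩
  smooth' := by
    obtain ⟨U, hU, hΔ, f, hf, hfσ⟩ := σ.smooth'
    refine ⟨faceMap k ⁻¹' U, hU.preimage (contDiff_faceMap k).continuous,
      fun t ht => hΔ (faceMap_mem k ht), f ∘ faceMap k, ?_, fun t => hfσ ⟨_, faceMap_mem k t.2⟩⟩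
    exact hf.comp (contDiff_faceMap k).contMDiff.contMDiffOn fun t ht => ht

/-- The boundary operator `∂σ = ∑ₖ (-1)ᵏ σ ∘ (k-th face)`. -/
def boundary (n : ℕ) : Chain M (n + 1) →+ Chain M n :=
  Finsupp.liftAddHom fun σ =>
    ∑ k : Fin (n + 2), ((-1 : ℤ) ^ (k : ℕ)) • Finsupp.singleAddHom (σ.face k)

/-- Chains all of whose simplices lie in the subset `A`. For an embedded submanifold `A` these are
the smooth singular chains of `A`. -/
def chainsIn (A : Set M) (n : ℕ) : AddSubgroup (Chain M n) where
  carrier := {c | ∀ σ ∈ c.support, range σ.toFun ⊆ A}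
  zero_mem' := by simp
  add_mem' := by
    classical
    intro c d hc hd σ hσ
    rcases Finset.mem_union.1 (Finsupp.support_add hσ) with h | h
    · exact hc σ h
    · exact hd σ h
  neg_mem' := by
    intro c hc σ hσ
    exact hc σ (by simpa using hσ)

/-- Relative cycles of `(M, A)` in degree `n + 1`. -/
def relCycles (A : Set M) (n : ℕ) : AddSubgroup (Chain M (n + 1)) :=
  (chainsIn A n).comap (boundary n)

/-- Chains of the form `∂S + Z`, with `S` a chain in `M` and `Z` a chain in `A`. -/
def relBoundaries (A : Set M) (n : ℕ) : AddSubgroup (Chain M (n + 1)) :=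
  (boundary (n + 1)).range ⊔ chainsIn A (n + 1)

/-- The relative homology group `H_{n+1}(M, A; ℤ)`, computed with smooth singular chains. -/
abbrev RelHomology (A : Set M) (n : ℕ) : Type _ :=
  relCycles A n ⧸ (relBoundaries A n).addSubgroupOf (relCycles A n)

/-- The class of a relative cycle. -/
def relClass (A : Set M) (n : ℕ) (c : relCycles A n) : RelHomology A n :=
  QuotientAddGroup.mk c

/-- The simplex as a map on `ℝⁿ` (with an irrelevant constant value off the standard simplex), so
that one can differentiate it at interior points of the standard simplex. -/
def SmoothSimplex.extend {n : ℕ} (σ : SmoothSimplex M n) (t : Fin n → ℝ) : M :=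
  open Classical in
  if h : t ∈ stdCorner n then σ.toFun ⟨t, h⟩ else σ.toFun ⟨0, zero_mem_stdCorner n⟩

variable {X : Type*} [TopologicalSpace X] [ChartedSpace (EuclideanHalfSpace 4) X]
  [IsManifold (𝓡∂ 4) ∞ X]

/-- `c` is a chain obtained by cutting the compact oriented submanifold `ι : X → M` into smooth
simplices: `c = ∑ᵢ εᵢ σᵢ` where the simplices `σᵢ` cover `X`, their interiors are embedded and
pairwise disjoint, `εᵢ = ±1` is the sign of `σᵢ` with respect to the orientation of `X`, and the
inner faces cancel, so that `∂c` is a chain in `∂X`. Such a chain (for instance the sum of the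
oriented simplices of a smooth triangulation of `X`) represents the fundamental class of
`(X, ∂X)`. -/
def IsFundamentalChain (ι : X → M) (o : ManifoldOrientation X) (c : Chain M 4) : Prop :=
  ∃ (N : ℕ) (σ : Fin N → SmoothSimplex M 4) (ε : Fin N → ℤˣ),
    c = ∑ i, Finsupp.single (σ i) (ε i : ℤ) ∧
    (⋃ i, range (σ i).toFun) = range ι ∧
    (∀ i, InjOn (σ i).extend (interior (stdCorner 4))) ∧
    (∀ i j, i ≠ j → Disjoint ((σ i).extend '' interior (stdCorner 4))
      ((σ j).extend '' interior (stdCorner 4))) ∧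
    (∀ i, ∀ t ∈ interior (stdCorner 4), ∃ y : X, ι y = (σ i).extend t ∧
      ∃ b : Basis (Fin 4) ℝ (TangentSpace (𝓡∂ 4) y),
        (∀ k, mfderiv (𝓡∂ 4) (𝓡 8) ι y (b k) =
          mfderiv 𝓘(ℝ, Fin 4 → ℝ) (𝓡 8) (σ i).extend t (Pi.single k (1 : ℝ) : Fin 4 → ℝ)) ∧
        b.orientation = if ε i = 1 then o.at' y else -o.at' y) ∧
    boundary 3 c ∈ chainsIn (ι '' (𝓡∂ 4).boundary X) 3

variable {Y : Type*} [TopologicalSpace Y] [ChartedSpace (EuclideanHalfSpace 4) Y]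
  [IsManifold (𝓡∂ 4) ∞ Y]

/-- The compact oriented submanifolds `X` and `Y`, with boundaries in `A`, lie in the same class in
`H_4(M, A; ℤ)`. -/
def SameRelHomologyClass (A : Set M) (ι : X → M) (o : ManifoldOrientation X)
    (κ : Y → M) (o' : ManifoldOrientation Y) : Prop :=
  ∃ c c' : relCycles A 3, IsFundamentalChain ι o c ∧ IsFundamentalChain κ o' c' ∧
    relClass A 3 c = relClass A 3 c'

end Chains

end CayleyGeometry

end

open CayleyGeometry

/-!
The form `Φ` calibrates the Cayley submanifolds: `Φ` is closed, and its value on four tangent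
vectors is at most the volume of the parallelepiped that they span. Cut `X` and `Y` into smooth
simplices. The integral of `Φ` over `Y` is then at most the volume of `Y`, the integral of `Φ` over
`X` is its volume, and the two integrals agree because the chains are homologous relative to `W` and
`Φ` vanishes on `W`.

* *The pointwise inequality.* On `ℝ⁸` one has
  `Φ₀(a, b, c, d) = ⟨a, c⟩⟨b, d⟩ - ⟨a, d⟩⟨b, c⟩ - ⟨a × b, c × d⟩` for the twofold cross product with
  values in `ℝ⁷`, and `|a × b|² = |a ∧ b|²` (`cayleyForm₀_eq`, `sum_cross_sq`). After `c` and `d`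
  are projected to the complement of `a` and `b`, the Cauchy-Schwarz inequality gives
  `Φ₀² ≤ det (Gram)` (`cayleyForm₀_sq_le`).
* *Continuity of the metric.* The metric is defined pointwise, through a choice of frames, so its
  continuity has to be recovered from that of `Φ`. For `ψ = A^* Φ₀` the determinant of the
  two-form `ψ(v, x, ·, ·)` on a complement of `v, x` determines `|det A| |Av ∧ Ax|²`
  (`det_contractionMatrix_sq`). By polarization one obtains `|det A|` times the adjugates of the
  `3 × 3` Gram matrices of vectors `Aa, Ax, Ay`, hence these Gram matrices up to the factor
  `√|det A|`, which the determinant of the `8 × 8` Gram matrix then determines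
  (`isFormContinuous_inner`).
* *Stokes.* A form that is parallel for a torsion-free connection is closed
  (`Spin7Structure.IsTorsionFree.extDeriv_formInChart`). The divergence theorem on the simplex
  (`setIntegral_divergence_stdCorner`) shows that its integral over boundaries is zero
  (`chainIntegral_boundary`). Simplices in `W` lift smoothly to `W`, so that `Φ` vanishes on them,
  and therefore the integral depends only on the relative homology class
  (`chainIntegral_eq_of_relClass_eq`).
* *Volume.* By the change of variables formula in charts, the volume of a submanifold is the sum of
  the volumes of its simplices (`vol_eq_sum_volume`).
* *Equality.* If the integral of `Φ` is the volume, then continuity gives the pointwise equality in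
  the interiors of all simplices. These are dense, as their complement is a null set in charts, and
  the Cayley condition is closed (`IsFundamentalChain.exists_vol_eq`).
-/

namespace CayleyGeometry

/-! ### The Cayley form and the twofold cross product -/

theorem det_fin_four (m : Fin 4 → Fin 4 → ℝ) : Matrix.det (Matrix.of m) =
    m 0 0 * (m 1 1 * (m 2 2 * m 3 3 - m 2 3 * m 3 2) - m 1 2 * (m 2 1 * m 3 3 - m 2 3 * m 3 1)
      + m 1 3 * (m 2 1 * m 3 2 - m 2 2 * m 3 1))
    - m 0 1 * (m 1 0 * (m 2 2 * m 3 3 - m 2 3 * m 3 2) - m 1 2 * (m 2 0 * m 3 3 - m 2 3 * m 3 0)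
      + m 1 3 * (m 2 0 * m 3 2 - m 2 2 * m 3 0))
    + m 0 2 * (m 1 0 * (m 2 1 * m 3 3 - m 2 3 * m 3 1) - m 1 1 * (m 2 0 * m 3 3 - m 2 3 * m 3 0)
      + m 1 3 * (m 2 0 * m 3 1 - m 2 1 * m 3 0))
    - m 0 3 * (m 1 0 * (m 2 1 * m 3 2 - m 2 2 * m 3 1) - m 1 1 * (m 2 0 * m 3 2 - m 2 2 * m 3 0)
      + m 1 2 * (m 2 0 * m 3 1 - m 2 1 * m 3 0)) := by
  simp [Matrix.det_succ_row_zero, Fin.sum_univ_succ, Fin.succAbove, Matrix.submatrix]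
  ring

/-- The components of the twofold cross product `ℝ⁸ × ℝ⁸ → ℝ⁷`, i.e. of `v ∧ w` projected to the
seven-dimensional summand of `Λ²` and rescaled. To the `m`-th of them, the coordinate pair
`(0, m + 1)` and three further pairs contribute. -/
noncomputable def cross (v w : EuclideanSpace ℝ (Fin 8)) : Fin 7 → ℝ :=
  let p (i j : Fin 8) : ℝ := v i * w j - v j * w i
  ![p 0 1 - p 2 3 - p 4 5 + p 6 7,
    p 0 2 + p 1 3 - p 4 6 - p 5 7,
    p 0 3 - p 1 2 - p 4 7 + p 5 6,
    p 0 4 + p 1 5 + p 2 6 + p 3 7,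
    p 0 5 - p 1 4 + p 2 7 - p 3 6,
    p 0 6 - p 1 7 - p 2 4 + p 3 5,
    p 0 7 + p 1 6 - p 2 5 - p 3 4]

theorem inner_eight (v w : EuclideanSpace ℝ (Fin 8)) :
    inner ℝ v w = v 0 * w 0 + v 1 * w 1 + v 2 * w 2 + v 3 * w 3 + v 4 * w 4 + v 5 * w 5
      + v 6 * w 6 + v 7 * w 7 := by
  simp [PiLp.inner_apply, Fin.sum_univ_eight]
  ring

set_option maxHeartbeats 4000000 in
/-- The Cayley form in terms of the inner product and the twofold cross product. -/
theorem cayleyForm₀_eq (v : Fin 4 → EuclideanSpace ℝ (Fin 8)) :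
    cayleyForm₀ v = inner ℝ (v 0) (v 2) * inner ℝ (v 1) (v 3)
      - inner ℝ (v 0) (v 3) * inner ℝ (v 1) (v 2)
      - ∑ m, cross (v 0) (v 1) m * cross (v 2) (v 3) m := by
  simp only [cayleyForm₀, ContinuousAlternatingMap.add_apply, ContinuousAlternatingMap.sub_apply,
    dx_apply, det_fin_four, inner_eight, cross, Fin.sum_univ_seven, Matrix.cons_val]
  ring

set_option maxHeartbeats 1000000 in
/-- The cross product has the length of `v ∧ w`. -/
theorem sum_cross_sq (v w : EuclideanSpace ℝ (Fin 8)) :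
    ∑ m, cross v w m ^ 2 = inner ℝ v v * inner ℝ w w - inner ℝ v w ^ 2 := by
  simp only [inner_eight, cross, Fin.sum_univ_seven, Matrix.cons_val]
  ring

/-- The linear combination with coefficients `c` of the seven anticommuting complex structures
that define the components of `cross`. -/
def crossMatrix (c : Fin 7 → ℝ) : Matrix (Fin 8) (Fin 8) ℝ :=
  !![0, c 0, c 1, c 2, c 3, c 4, c 5, c 6;
     -c 0, 0, -c 2, c 1, -c 4, c 3, c 6, -c 5;
     -c 1, c 2, 0, -c 0, -c 5, -c 6, c 3, c 4;
     -c 2, -c 1, c 0, 0, -c 6, c 5, -c 4, c 3;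
     -c 3, c 4, c 5, c 6, 0, -c 0, -c 1, -c 2;
     -c 4, -c 3, c 6, -c 5, c 0, 0, c 2, -c 1;
     -c 5, -c 6, -c 3, c 4, c 1, -c 2, 0, c 0;
     -c 6, c 5, -c 4, -c 3, c 2, c 1, -c 0, 0]

theorem sum_mul_cross (c : Fin 7 → ℝ) (v w : EuclideanSpace ℝ (Fin 8)) :
    ∑ m, c m * cross v w m = ∑ k, ∑ l, v k * crossMatrix c k l * w l := by
  simp only [cross, crossMatrix, Fin.sum_univ_seven, Fin.sum_univ_eight, Matrix.cons_val,
    Matrix.of_apply]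
  ring

/-- The Clifford relations of the seven complex structures. -/
theorem crossMatrix_mul_transpose (c : Fin 7 → ℝ) :
    crossMatrix c * (crossMatrix c).transpose =
      (∑ m, c m ^ 2) • (1 : Matrix (Fin 8) (Fin 8) ℝ) := by
  ext i j
  fin_cases i <;> fin_cases j <;>
  · simp [crossMatrix, Matrix.mul_apply, Fin.sum_univ_seven, Fin.sum_univ_eight]
    try ring

theorem det_crossMatrix_sq (c : Fin 7 → ℝ) :
    (crossMatrix c).det ^ 2 = (∑ m, c m ^ 2) ^ 8 := by
  have h := congrArg Matrix.det (crossMatrix_mul_transpose c)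
  rw [Matrix.det_mul, Matrix.det_transpose, Matrix.det_smul, Matrix.det_one] at h
  simpa [sq] using h

theorem map_vec4_third (f : EuclideanSpace ℝ (Fin 8) [⋀^Fin 4]→L[ℝ] ℝ)
    (a b w z : EuclideanSpace ℝ (Fin 8)) (r s t : ℝ) :
    f ![a, b, r • w - s • a - t • b, z] = r * f ![a, b, w, z] := by
  have h : ∀ x, ![a, b, x, z] = Function.update ![a, b, 0, z] 2 x := by
    intro x; ext i; fin_cases i <;> rfl
  rw [h (r • w - s • a - t • b)]
  simp only [f.map_update_sub, f.map_update_smul]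
  rw [← h, ← h, ← h, f.map_eq_zero_of_eq ![a, b, a, z] (i := 0) (j := 2) rfl (by decide),
    f.map_eq_zero_of_eq ![a, b, b, z] (i := 1) (j := 2) rfl (by decide)]
  simp

theorem map_vec4_fourth (f : EuclideanSpace ℝ (Fin 8) [⋀^Fin 4]→L[ℝ] ℝ)
    (a b w z : EuclideanSpace ℝ (Fin 8)) (r s t : ℝ) :
    f ![a, b, w, r • z - s • a - t • b] = r * f ![a, b, w, z] := by
  have h : ∀ x, ![a, b, w, x] = Function.update ![a, b, w, 0] 3 x := by
    intro x; ext i; fin_cases i <;> rfl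
  rw [h (r • z - s • a - t • b)]
  simp only [f.map_update_sub, f.map_update_smul]
  rw [← h, ← h, ← h, f.map_eq_zero_of_eq ![a, b, w, a] (i := 0) (j := 3) rfl (by decide),
    f.map_eq_zero_of_eq ![a, b, w, b] (i := 1) (j := 3) rfl (by decide)]
  simp

theorem real_inner_self_mul_sub_sq_pos {V : Type*} [NormedAddCommGroup V] [InnerProductSpace ℝ V]
    {v x : V} (h : LinearIndependent ℝ ![v, x]) :
    0 < inner ℝ v v * inner ℝ x x - inner ℝ v x ^ 2 := by
  rw [LinearIndependent.pair_iff] at h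
  have hv : inner ℝ v v ≠ 0 := by
    intro h0
    rw [inner_self_eq_zero] at h0
    simpa using h 1 0 (by simp [h0])
  have hv' : 0 < inner ℝ v v := lt_of_le_of_ne real_inner_self_nonneg hv.symm
  have hw : inner ℝ v v • x - inner ℝ v x • v ≠ 0 := by
    intro h0
    exact hv (h (-inner ℝ v x) (inner ℝ v v) (by rw [← h0]; module)).2
  have hp : 0 < inner ℝ (inner ℝ v v • x - inner ℝ v x • v) (inner ℝ v v • x - inner ℝ v x • v) :=
    lt_of_le_of_ne real_inner_self_nonneg (fun h0 => hw (inner_self_eq_zero.1 h0.symm))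
  simp only [inner_sub_left, inner_sub_right, inner_smul_left, inner_smul_right,
    real_inner_comm v x, RCLike.conj_to_real] at hp
  have : inner ℝ v v * (inner ℝ v v * inner ℝ x x - inner ℝ v x ^ 2) > 0 := by
    rw [real_inner_comm x v] at hp ⊢
    linarith
  exact (pos_iff_pos_of_mul_pos this).1 hv'

set_option maxHeartbeats 1000000 in
/-- The form `Φ₀` is a calibration: it is bounded by the volume of the spanned parallelepiped. -/
theorem cayleyForm₀_sq_le (v : Fin 4 → EuclideanSpace ℝ (Fin 8)) :
    cayleyForm₀ v ^ 2 ≤ Matrix.det (Matrix.of fun i j => inner ℝ (v i) (v j) : Matrix _ _ ℝ) := by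
  by_cases hind : LinearIndependent ℝ ![v 0, v 1]
  · obtain ⟨a, b, w, z, rfl⟩ : ∃ a b w z, v = ![a, b, w, z] :=
      ⟨v 0, v 1, v 2, v 3, by ext i; fin_cases i <;> rfl⟩
    have hg := real_inner_self_mul_sub_sq_pos hind
    simp only [Matrix.cons_val_zero, Matrix.cons_val_one] at hg
    set g := inner ℝ a a * inner ℝ b b - inner ℝ a b ^ 2 with hgdef
    -- `w'` and `z'` are `g` times the projections of `w` and `z` to the complement of `span(a, b)`
    set w' := g • w - (inner ℝ a w * inner ℝ b b - inner ℝ b w * inner ℝ a b) • a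
      - (inner ℝ b w * inner ℝ a a - inner ℝ a w * inner ℝ a b) • b with hw'
    set z' := g • z - (inner ℝ a z * inner ℝ b b - inner ℝ b z * inner ℝ a b) • a
      - (inner ℝ b z * inner ℝ a a - inner ℝ a z * inner ℝ a b) • b with hz'
    have h1 : cayleyForm₀ ![a, b, w', z'] = g * (g * cayleyForm₀ ![a, b, w, z]) := by
      rw [hw', map_vec4_third, hz', map_vec4_fourth]
    have hba : inner ℝ b a = inner ℝ a b := real_inner_comm _ _
    have haw : inner ℝ a w' = 0 := by
      simp only [hw', inner_sub_right, inner_smul_right, hgdef]; ring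
    have hbw : inner ℝ b w' = 0 := by
      simp only [hw', inner_sub_right, inner_smul_right, hgdef, hba]; ring
    have haz : inner ℝ a z' = 0 := by
      simp only [hz', inner_sub_right, inner_smul_right, hgdef]; ring
    have hbz : inner ℝ b z' = 0 := by
      simp only [hz', inner_sub_right, inner_smul_right, hgdef, hba]; ring
    have h2 : cayleyForm₀ ![a, b, w', z'] = - ∑ m, cross a b m * cross w' z' m := by
      rw [cayleyForm₀_eq]
      simp [haw, hbz, haz]
    have h3 : (∑ m, cross a b m * cross w' z' m) ^ 2
        ≤ g * (inner ℝ w' w' * inner ℝ z' z' - inner ℝ w' z' ^ 2) := by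
      rw [hgdef, ← sum_cross_sq, ← sum_cross_sq]
      exact Finset.sum_mul_sq_le_sq_mul_sq _ _ _
    have h4 : inner ℝ w' w' * inner ℝ z' z' - inner ℝ w' z' ^ 2 = g ^ 3 *
        Matrix.det (Matrix.of fun i j => inner ℝ (![a, b, w, z] i) (![a, b, w, z] j) :
          Matrix _ _ ℝ) := by
      have e1 : inner ℝ w' w' = g * inner ℝ w w'  := by
        conv_lhs => enter [2]; rw [hw']
        simp only [inner_sub_left, inner_smul_left, haw, hbw, RCLike.conj_to_real]; ring
      have e2 : inner ℝ z' z' = g * inner ℝ z z'  := by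
        conv_lhs => enter [2]; rw [hz']
        simp only [inner_sub_left, inner_smul_left, haz, hbz, RCLike.conj_to_real]; ring
      have e3 : inner ℝ w' z' = g * inner ℝ w z'  := by
        conv_lhs => enter [2]; rw [hw']
        simp only [inner_sub_left, inner_smul_left, haz, hbz, RCLike.conj_to_real]; ring
      rw [e1, e2, e3, det_fin_four]
      simp only [Matrix.cons_val, hw', hz', inner_sub_right, inner_smul_right, hba,
        real_inner_comm a w, real_inner_comm b w, real_inner_comm a z, real_inner_comm b z,
        real_inner_comm w z, hgdef]
      ring
    rw [h4] at h3
    have h5 : (g * (g * cayleyForm₀ ![a, b, w, z])) ^ 2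
        = (∑ m, cross a b m * cross w' z' m) ^ 2 := by rw [← h1, h2, neg_sq]
    have h6 : g ^ 4 * cayleyForm₀ ![a, b, w, z] ^ 2 ≤ g ^ 4 *
        Matrix.det (Matrix.of fun i j => inner ℝ (![a, b, w, z] i) (![a, b, w, z] j) :
          Matrix _ _ ℝ) := by
      calc _ = (g * (g * cayleyForm₀ ![a, b, w, z])) ^ 2 := by ring
        _ ≤ _ := by rw [h5]; linarith [h3]
    clear_value g
    generalize cayleyForm₀ ![a, b, w, z] ^ 2 = A at h6 ⊢
    generalize Matrix.det (Matrix.of fun i j =>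
      inner ℝ (![a, b, w, z] i) (![a, b, w, z] j) : Matrix (Fin 4) (Fin 4) ℝ) = D at h6 ⊢
    exact le_of_mul_le_mul_left h6 (pow_pos hg 4)
  · have : ¬ LinearIndependent ℝ v := by
      intro h
      apply hind
      have := h.comp ![0, 1] (by decide)
      convert this using 1
      ext i; fin_cases i <;> rfl
    have h0 : cayleyForm₀ v = 0 := cayleyForm₀.toAlternatingMap.map_linearDependent v this
    rw [h0]
    have h1 := (Matrix.posSemidef_gram ℝ v).det_nonneg
    rw [zero_pow two_ne_zero]
    exact h1

/-! ### The determinant of a contraction of the Cayley form -/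

/-- The squared area of the parallelogram spanned by two vectors. -/
noncomputable def areaSq (v x : EuclideanSpace ℝ (Fin 8)) : ℝ :=
  inner ℝ v v * inner ℝ x x - inner ℝ v x ^ 2

/-- The `6 × 6` matrix of the two-form `ψ(p₀, p₁, ·, ·)` on the vectors `p₂, …, p₇`. -/
noncomputable def contractionMatrix (ψ : EuclideanSpace ℝ (Fin 8) [⋀^Fin 4]→L[ℝ] ℝ)
    (p : Fin 8 → EuclideanSpace ℝ (Fin 8)) : Matrix (Fin 6) (Fin 6) ℝ :=
  Matrix.of fun i j => ψ ![p 0, p 1, p (Fin.natAdd 2 i), p (Fin.natAdd 2 j)]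

/-- For vectors `v, x` in `ℝ⁸`, the third exterior power of the two-form `Φ₀(v, x, ·, ·)` is the
contraction of the volume form with `v` and `x`, up to a constant and the squared area of `v ∧ x`.
Here this is expressed through the determinant of a skew-symmetric `6 × 6` matrix, which is a Schur
complement in the `8 × 8` matrix of the form `⟨v × x, · × ·⟩`. -/
theorem det_contractionMatrix_sq (p : Fin 8 → EuclideanSpace ℝ (Fin 8))
    (hp : LinearIndependent ℝ ![p 0, p 1]) :
    (contractionMatrix cayleyForm₀ p).det ^ 2 =
      areaSq (p 0) (p 1) ^ 4 * (Matrix.of fun i k => p i k).det ^ 4 := by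
  have hg : 0 < areaSq (p 0) (p 1) := real_inner_self_mul_sub_sq_pos hp
  set g := areaSq (p 0) (p 1) with hgdef
  set c := cross (p 0) (p 1) with hc
  set P : Matrix (Fin 8) (Fin 8) ℝ := Matrix.of fun i k => p i k with hP
  have hcg : ∑ m, c m ^ 2 = g := sum_cross_sq _ _
  set Q : Matrix (Fin 8) (Fin 8) ℝ := Matrix.of fun i j => ∑ m, c m * cross (p i) (p j) m with hQ
  have hQP : Q = P * crossMatrix c * P.transpose := by
    ext i j
    simp only [hQ, hP, Matrix.of_apply, sum_mul_cross, Matrix.mul_apply, Matrix.transpose_apply,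
      Finset.sum_mul]
    exact Finset.sum_comm
  have hQdet : Q.det ^ 2 = P.det ^ 4 * g ^ 8 := by
    rw [hQP, Matrix.det_mul, Matrix.det_mul, Matrix.det_transpose, mul_pow, mul_pow,
      det_crossMatrix_sq, hcg]
    ring
  have hΦ : ∀ i j, Q i j = inner ℝ (p 0) (p i) * inner ℝ (p 1) (p j)
      - inner ℝ (p 0) (p j) * inner ℝ (p 1) (p i) - cayleyForm₀ ![p 0, p 1, p i, p j] := by
    intro i j
    rw [cayleyForm₀_eq]
    simp [hQ, hc]
  have h0 : ∀ j, cayleyForm₀ ![p 0, p 1, p 0, p j] = 0 := fun j =>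
    cayleyForm₀.map_eq_zero_of_eq _ (i := 0) (j := 2) rfl (by decide)
  have h1 : ∀ j, cayleyForm₀ ![p 0, p 1, p 1, p j] = 0 := fun j =>
    cayleyForm₀.map_eq_zero_of_eq _ (i := 1) (j := 2) rfl (by decide)
  have h0' : ∀ j, cayleyForm₀ ![p 0, p 1, p j, p 0] = 0 := fun j =>
    cayleyForm₀.map_eq_zero_of_eq _ (i := 0) (j := 3) rfl (by decide)
  have h1' : ∀ j, cayleyForm₀ ![p 0, p 1, p j, p 1] = 0 := fun j =>
    cayleyForm₀.map_eq_zero_of_eq _ (i := 1) (j := 3) rfl (by decide)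
  set a := fun i : Fin 6 => inner ℝ (p 0) (p (Fin.natAdd 2 i)) with ha
  set b := fun i : Fin 6 => inner ℝ (p 1) (p (Fin.natAdd 2 i)) with hb
  set s := inner ℝ (p 0) (p 0) with hs
  set t := inner ℝ (p 1) (p 1) with ht
  set r := inner ℝ (p 0) (p 1) with hr
  have hr' : inner ℝ (p 1) (p 0) = r := real_inner_comm _ _
  have hgst : g = s * t - r ^ 2 := rfl
  -- the blocks of `Q` with respect to the splitting `8 = 2 + 6`
  set S : Matrix (Fin 2) (Fin 2) ℝ := !![0, g; -g, 0] with hS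
  set B : Matrix (Fin 2) (Fin 6) ℝ :=
    Matrix.of fun k j => Q (Fin.castAdd 6 k) (Fin.natAdd 2 j) with hB
  set C : Matrix (Fin 6) (Fin 2) ℝ :=
    Matrix.of fun i k => Q (Fin.natAdd 2 i) (Fin.castAdd 6 k) with hC
  set E : Matrix (Fin 6) (Fin 6) ℝ :=
    Matrix.of fun i j => Q (Fin.natAdd 2 i) (Fin.natAdd 2 j) with hE
  have hblock : Q.submatrix finSumFinEquiv finSumFinEquiv = Matrix.fromBlocks S B C E := by
    ext i j
    rcases i with i | i <;> rcases j with j | j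
    · have q00 : Q 0 0 = 0 := by rw [hΦ, h0]; ring
      have q01 : Q 0 1 = g := by rw [hΦ, h0, hr', hgst]; ring
      have q10 : Q 1 0 = -g := by rw [hΦ, h1, hr', hgst]; ring
      have q11 : Q 1 1 = 0 := by rw [hΦ, h1]; ring
      fin_cases i <;> fin_cases j
      exacts [q00, q01, q10, q11]
    · rfl
    · rfl
    · rfl
  have hSdet : S.det = g ^ 2 := by simp [hS, Matrix.det_fin_two_of, sq]
  have hSu : IsUnit S.det := by rw [hSdet]; exact (pow_pos hg 2).ne'.isUnit
  let _ := S.invertibleOfIsUnitDet hSu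
  have hSinv : ⅟S = !![0, -g⁻¹; g⁻¹, 0] := by
    apply invOf_eq_right_inv
    ext i j
    fin_cases i <;> fin_cases j <;> simp [hS, Matrix.mul_apply, hg.ne']
  have hB0 : ∀ j, B 0 j = s * b j - r * a j := by
    intro j
    have : B 0 j = Q 0 (Fin.natAdd 2 j) := rfl
    rw [this, hΦ, h0, ← hs, hr']
    simp only [ha, hb]; ring
  have hB1 : ∀ j, B 1 j = r * b j - t * a j := by
    intro j
    have : B 1 j = Q 1 (Fin.natAdd 2 j) := rfl
    rw [this, hΦ, h1, ← ht, ← hr]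
    simp only [ha, hb]; ring
  have hC0 : ∀ j, C j 0 = r * a j - s * b j := by
    intro j
    have : C j 0 = Q (Fin.natAdd 2 j) 0 := rfl
    rw [this, hΦ, h0', ← hs, hr']
    simp only [ha, hb]; ring
  have hC1 : ∀ j, C j 1 = t * a j - r * b j := by
    intro j
    have : C j 1 = Q (Fin.natAdd 2 j) 1 := rfl
    rw [this, hΦ, h1', ← ht, ← hr]
    simp only [ha, hb]; ring
  have hschur : E - C * ⅟S * B = -contractionMatrix cayleyForm₀ p := by
    ext i j
    have hE' : E i j = a i * b j - a j * b i - contractionMatrix cayleyForm₀ p i j := by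
      simp only [hE, Matrix.of_apply, hΦ, ha, hb, contractionMatrix]
    rw [Matrix.sub_apply, hE', hSinv]
    simp only [Matrix.mul_apply, Fin.sum_univ_two, hB0, hB1, hC0, hC1, Matrix.neg_apply,
      Matrix.of_apply, Matrix.cons_val', Matrix.cons_val_zero, Matrix.cons_val_one,
      Matrix.cons_val_fin_one]
    field_simp
    rw [hgst]
    ring
  have hdet : Q.det = g ^ 2 * (contractionMatrix cayleyForm₀ p).det := by
    rw [← Matrix.det_submatrix_equiv_self (finSumFinEquiv (m := 2) (n := 6)) Q, hblock,
      Matrix.det_fromBlocks₁₁, hschur, hSdet, Matrix.det_neg, Fintype.card_fin,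
      (by decide : Even 6).neg_one_pow, one_mul]
  rw [hdet, mul_pow] at hQdet
  have : g ^ 4 * ((contractionMatrix cayleyForm₀ p).det ^ 2) = g ^ 4 * (g ^ 4 * P.det ^ 4) := by
    linarith [hQdet]
  exact mul_left_cancel₀ (pow_pos hg 4).ne' this

/-- The Pfaffian form of `det_contractionMatrix_sq`, up to sign. -/
theorem sqrt_abs_det_contractionMatrix (p : Fin 8 → EuclideanSpace ℝ (Fin 8))
    (hp : LinearIndependent ℝ ![p 0, p 1]) :
    √|(contractionMatrix cayleyForm₀ p).det| =
      areaSq (p 0) (p 1) * |(Matrix.of fun i k => p i k).det| := by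
  have hg : 0 < areaSq (p 0) (p 1) := real_inner_self_mul_sub_sq_pos hp
  have h := det_contractionMatrix_sq p hp
  have h2 : |(contractionMatrix cayleyForm₀ p).det| =
      (areaSq (p 0) (p 1) * |(Matrix.of fun i k => p i k).det|) ^ 2 := by
    rw [← sq_eq_sq₀ (abs_nonneg _) (by positivity), sq_abs, h]
    rw [← pow_mul, mul_pow, show 2 * 2 = 4 from rfl, (by decide : Even 4).pow_abs]
  rw [h2, Real.sqrt_sq (by positivity)]

/-! ### The metric as a continuous function of the form -/

/-- The pullback of `Φ₀` under a linear automorphism of `ℝ⁸`. -/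
noncomputable def pullbackForm (A : EuclideanSpace ℝ (Fin 8) ≃L[ℝ] EuclideanSpace ℝ (Fin 8)) :
    EuclideanSpace ℝ (Fin 8) [⋀^Fin 4]→L[ℝ] ℝ :=
  cayleyForm₀.compContinuousLinearMap (A : EuclideanSpace ℝ (Fin 8) →L[ℝ] EuclideanSpace ℝ (Fin 8))

/-- A function of linear automorphisms `A` of `ℝ⁸` that is a function of the form `A^* Φ₀` alone,
and depends continuously on this form. -/
def IsFormContinuous
    (F : (EuclideanSpace ℝ (Fin 8) ≃L[ℝ] EuclideanSpace ℝ (Fin 8)) → ℝ) : Prop :=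
  ∃ f : (EuclideanSpace ℝ (Fin 8) [⋀^Fin 4]→L[ℝ] ℝ) → ℝ,
    ContinuousOn f (range pullbackForm) ∧ ∀ A, f (pullbackForm A) = F A

namespace IsFormContinuous

variable {F G : (EuclideanSpace ℝ (Fin 8) ≃L[ℝ] EuclideanSpace ℝ (Fin 8)) → ℝ}

theorem const (r : ℝ) : IsFormContinuous fun _ => r :=
  ⟨fun _ => r, continuousOn_const, fun _ => rfl⟩

theorem add (hF : IsFormContinuous F) (hG : IsFormContinuous G) :
    IsFormContinuous fun A => F A + G A := by
  obtain ⟨f, hf, hfF⟩ := hF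
  obtain ⟨g, hg, hgG⟩ := hG
  exact ⟨fun ψ => f ψ + g ψ, hf.add hg, fun A => by simp only [hfF, hgG]⟩

theorem mul (hF : IsFormContinuous F) (hG : IsFormContinuous G) :
    IsFormContinuous fun A => F A * G A := by
  obtain ⟨f, hf, hfF⟩ := hF
  obtain ⟨g, hg, hgG⟩ := hG
  exact ⟨fun ψ => f ψ * g ψ, hf.mul hg, fun A => by simp only [hfF, hgG]⟩

theorem sub (hF : IsFormContinuous F) (hG : IsFormContinuous G) :
    IsFormContinuous fun A => F A - G A := by
  obtain ⟨f, hf, hfF⟩ := hF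
  obtain ⟨g, hg, hgG⟩ := hG
  exact ⟨fun ψ => f ψ - g ψ, hf.sub hg, fun A => by simp only [hfF, hgG]⟩

theorem div (hF : IsFormContinuous F) (hG : IsFormContinuous G) (h0 : ∀ A, G A ≠ 0) :
    IsFormContinuous fun A => F A / G A := by
  obtain ⟨f, hf, hfF⟩ := hF
  obtain ⟨g, hg, hgG⟩ := hG
  refine ⟨fun ψ => f ψ / g ψ, hf.div hg ?_, fun A => by simp only [hfF, hgG]⟩
  rintro _ ⟨A, rfl⟩
  rw [hgG]
  exact h0 A

theorem comp (hF : IsFormContinuous F) {φ : ℝ → ℝ} (hφ : Continuous φ) :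
    IsFormContinuous fun A => φ (F A) := by
  obtain ⟨f, hf, hfF⟩ := hF
  exact ⟨fun ψ => φ (f ψ), hφ.comp_continuousOn hf, fun A => by simp only [hfF]⟩

theorem det {k : ℕ} {F : Fin k → Fin k →
      (EuclideanSpace ℝ (Fin 8) ≃L[ℝ] EuclideanSpace ℝ (Fin 8)) → ℝ}
    (hF : ∀ i j, IsFormContinuous (F i j)) :
    IsFormContinuous fun A => Matrix.det (Matrix.of fun i j => F i j A) := by
  choose f hf hfF using hF
  refine ⟨fun ψ => Matrix.det (Matrix.of fun i j => f i j ψ), ?_, fun A => by simp only [hfF]⟩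
  have h1 : ContinuousOn (fun ψ i j => f i j ψ) (range pullbackForm) :=
    continuousOn_pi.2 fun i => continuousOn_pi.2 fun j => hf i j
  exact (Continuous.matrix_det continuous_id).comp_continuousOn h1

theorem apply (v : Fin 4 → EuclideanSpace ℝ (Fin 8)) :
    IsFormContinuous fun A => cayleyForm₀ (fun k => A (v k)) :=
  ⟨fun ψ => ψ v, (by fun_prop : Continuous fun ψ :
    EuclideanSpace ℝ (Fin 8) [⋀^Fin 4]→L[ℝ] ℝ => ψ v).continuousOn, fun A => rfl⟩

end IsFormContinuous

/-- The factor by which a linear automorphism scales volumes. -/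
noncomputable def volumeFactor (A : EuclideanSpace ℝ (Fin 8) ≃L[ℝ] EuclideanSpace ℝ (Fin 8)) : ℝ :=
  |LinearMap.det (A : EuclideanSpace ℝ (Fin 8) →ₗ[ℝ] EuclideanSpace ℝ (Fin 8))|

theorem volumeFactor_pos (A : EuclideanSpace ℝ (Fin 8) ≃L[ℝ] EuclideanSpace ℝ (Fin 8)) :
    0 < volumeFactor A :=
  abs_pos.2 (LinearEquiv.isUnit_det' A.toLinearEquiv).ne_zero

theorem det_coord_map (A : EuclideanSpace ℝ (Fin 8) ≃L[ℝ] EuclideanSpace ℝ (Fin 8))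
    (p : Fin 8 → EuclideanSpace ℝ (Fin 8)) :
    (Matrix.of fun i k => A (p i) k).det =
      LinearMap.det (A : EuclideanSpace ℝ (Fin 8) →ₗ[ℝ] EuclideanSpace ℝ (Fin 8)) *
        (Matrix.of fun i k => p i k).det := by
  have key : ∀ q : Fin 8 → EuclideanSpace ℝ (Fin 8), (Matrix.of fun i k => q i k).det =
      (EuclideanSpace.basisFun (Fin 8) ℝ).toBasis.det q := by
    intro q
    rw [Basis.det_apply, ← Matrix.det_transpose]
    congr 1
  rw [key, key, ← Basis.det_comp]
  rfl

theorem exists_extend_linearIndependent {k m : ℕ} (hkm : k ≤ m) (hm : m ≤ 8)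
    (v : Fin k → EuclideanSpace ℝ (Fin 8)) (hv : LinearIndependent ℝ v) :
    ∃ p : Fin m → EuclideanSpace ℝ (Fin 8), LinearIndependent ℝ p ∧
      ∀ i : Fin k, p (Fin.castLE hkm i) = v i := by
  induction m, hkm using Nat.le_induction with
  | base => exact ⟨v, hv, fun i => rfl⟩
  | succ m hkm ih =>
    obtain ⟨p, hp, hpv⟩ := ih (by omega)
    obtain ⟨x, hx⟩ := exists_linearIndependent_snoc_of_lt_finrank (R := ℝ) hp
      (by rw [finrank_euclideanSpace_fin]; omega)
    refine ⟨_, hx, fun i => ?_⟩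
    rw [← hpv i]
    exact Fin.snoc_castSucc (α := fun _ => EuclideanSpace ℝ (Fin 8)) x p (Fin.castLE hkm i)

/-- The squared area of `A v ∧ A x`, scaled by the volume factor of `A`, is read off from the
determinant of a contraction of `A^* Φ₀`, divided by that of a basis which extends `v, x`. -/
theorem isFormContinuous_areaSq {v x : EuclideanSpace ℝ (Fin 8)}
    (h : LinearIndependent ℝ ![v, x]) :
    IsFormContinuous fun A => volumeFactor A * areaSq (A v) (A x) := by
  obtain ⟨p, hp, hpv⟩ := exists_extend_linearIndependent (m := 8) (by norm_num) le_rfl _ h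
  have h0 : p 0 = v := hpv 0
  have h1 : p 1 = x := hpv 1
  set d := |(Matrix.of fun i k => p i k).det| with hd
  have hd0 : d ≠ 0 := by
    rw [hd, abs_ne_zero, ← Matrix.det_transpose]
    have hb := Module.Basis.is_basis_iff_det (EuclideanSpace.basisFun (Fin 8) ℝ).toBasis (v := p)
    have hu := (hb.1 ⟨hp, hp.span_eq_top_of_card_eq_finrank' (by simp)⟩).ne_zero
    rwa [Basis.det_apply] at hu
  have hc := (((IsFormContinuous.det (F := fun i j A => contractionMatrix cayleyForm₀
    (fun i => A (p i)) i j) (fun i j => by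
      convert IsFormContinuous.apply ![p 0, p 1, p (Fin.natAdd 2 i), p (Fin.natAdd 2 j)] using 2
      simp only [contractionMatrix, Matrix.of_apply]
      congr 1
      ext k; fin_cases k <;> rfl)).comp continuous_abs).comp Real.continuous_sqrt).div
    (IsFormContinuous.const d) (fun _ => hd0)
  convert hc using 2 with A
  have hA : LinearIndependent ℝ ![A (p 0), A (p 1)] := by
    rw [h0, h1]
    have := h.map' (A : EuclideanSpace ℝ (Fin 8) →ₗ[ℝ] EuclideanSpace ℝ (Fin 8))
      (LinearMap.ker_eq_bot.2 A.injective)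
    rwa [show ![A v, A x] =
      (A : EuclideanSpace ℝ (Fin 8) →ₗ[ℝ] EuclideanSpace ℝ (Fin 8)) ∘ ![v, x] by
      ext1 k; fin_cases k <;> rfl]
  have := sqrt_abs_det_contractionMatrix (fun i => A (p i)) hA
  rw [show (Matrix.of fun i j => contractionMatrix cayleyForm₀ (fun i => A (p i)) i j) =
    contractionMatrix cayleyForm₀ (fun i => A (p i)) from rfl, this, det_coord_map, abs_mul,
    ← hd, ← h0, ← h1, volumeFactor]
  field_simp

/-- The polarization of `isFormContinuous_areaSq` in the second vector. -/
theorem isFormContinuous_polar {v x y : EuclideanSpace ℝ (Fin 8)}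
    (h : ∀ r s t : ℝ, r • v + s • x + t • y = 0 → r = 0 ∧ s = 0 ∧ t = 0) :
    IsFormContinuous fun A => volumeFactor A *
      (inner ℝ (A v) (A v) * inner ℝ (A x) (A y) - inner ℝ (A v) (A x) * inner ℝ (A v) (A y)) := by
  have hx : LinearIndependent ℝ ![v, x] := LinearIndependent.pair_iff.2 fun r s hrs => by
    have := h r s 0 (by simpa using hrs)
    tauto
  have hy : LinearIndependent ℝ ![v, y] := LinearIndependent.pair_iff.2 fun r s hrs => by
    have := h r 0 s (by simpa using hrs)
    tauto
  have hxy : LinearIndependent ℝ ![v, x + y] := LinearIndependent.pair_iff.2 fun r s hrs => by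
    have := h r s s (by rw [← hrs]; module)
    tauto
  convert (IsFormContinuous.const (1 / 2)).mul (((isFormContinuous_areaSq hxy).sub
    (isFormContinuous_areaSq hx)).sub (isFormContinuous_areaSq hy)) using 2 with A
  simp only [areaSq, map_add, inner_add_left, inner_add_right, real_inner_comm (A x) (A y)]
  ring

/-- Let `G` be the Gram matrix of `A a, A x, A y` for independent `a, x, y`, and `c` the volume
factor of `A`. The entries of `N = c • adj G` are known to depend continuously on `A^* Φ₀`, and `G`
is recovered up to a factor from `adj N = (c ^ 2 * det G) • G` and `det N = c ^ 3 * (det G) ^ 2`. -/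
theorem isFormContinuous_sqrt_mul_inner_self (a : EuclideanSpace ℝ (Fin 8)) :
    IsFormContinuous fun A => √(volumeFactor A) * inner ℝ (A a) (A a) := by
  by_cases ha : a = 0
  · subst ha
    simpa using IsFormContinuous.const 0
  obtain ⟨p, hp, hpa⟩ := exists_extend_linearIndependent (k := 1) (m := 3) (by norm_num)
    (by norm_num) ![a] (by simpa using ha)
  obtain ⟨x, y, rfl⟩ : ∃ x y, p = ![a, x, y] := by
    refine ⟨p 1, p 2, ?_⟩
    ext i; fin_cases i
    · exact congrArg (fun z : EuclideanSpace ℝ (Fin 8) => z _) (hpa 0)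
    · rfl
    · rfl
  have h : ∀ r s t : ℝ, r • a + s • x + t • y = 0 → r = 0 ∧ s = 0 ∧ t = 0 := by
    intro r s t hrst
    have := Fintype.linearIndependent_iff.1 hp ![r, s, t] (by simpa [Fin.sum_univ_three] using hrst)
    exact ⟨this 0, this 1, this 2⟩
  have hax : LinearIndependent ℝ ![a, x] := LinearIndependent.pair_iff.2 fun r s hrs => by
    have := h r s 0 (by simpa using hrs)
    tauto
  have hay : LinearIndependent ℝ ![a, y] := LinearIndependent.pair_iff.2 fun r s hrs => by
    have := h r 0 s (by simpa using hrs)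
    tauto
  have hxy : LinearIndependent ℝ ![x, y] := LinearIndependent.pair_iff.2 fun r s hrs => by
    have := h 0 r s (by simpa using hrs)
    tauto
  -- the entries of `c` times the adjugate of the Gram matrix of `A a, A x, A y`
  have m11 := isFormContinuous_areaSq hxy
  have m22 := isFormContinuous_areaSq hay
  have m33 := isFormContinuous_areaSq hax
  have m23 := isFormContinuous_polar h
  have m12 := isFormContinuous_polar (v := y) (x := a) (y := x) fun r s t hrst => by
    have := h s t r (by rw [← hrst]; module)
    tauto
  have m13 := isFormContinuous_polar (v := x) (x := a) (y := y) fun r s t hrst => by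
    have := h s r t (by rw [← hrst]; module)
    tauto
  have hdet := (m11.mul ((m22.mul m33).sub (m23.mul m23))).sub
    (((m12.mul m12).mul m33).add ((((m13.mul m13).mul m22).add
      (((m12.mul m13).mul m23).mul (IsFormContinuous.const 2)))))
  have hcof := (m22.mul m33).sub (m23.mul m23)
  set D : (EuclideanSpace ℝ (Fin 8) ≃L[ℝ] EuclideanSpace ℝ (Fin 8)) → ℝ := fun A =>
    Matrix.det (Matrix.of fun i j => inner ℝ (![A a, A x, A y] i) (![A a, A x, A y] j) :
      Matrix _ _ ℝ) with hD
  have hD0 : ∀ A, 0 < D A := by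
    intro A
    have hA : LinearIndependent ℝ ![A a, A x, A y] := by
      have := hp.map' (A : EuclideanSpace ℝ (Fin 8) →ₗ[ℝ] EuclideanSpace ℝ (Fin 8))
        (LinearMap.ker_eq_bot.2 A.injective)
      rwa [show ![A a, A x, A y] =
        (A : EuclideanSpace ℝ (Fin 8) →ₗ[ℝ] EuclideanSpace ℝ (Fin 8)) ∘ ![a, x, y] by
        ext1 k; fin_cases k <;> rfl]
    exact (Matrix.posDef_gram_of_linearIndependent hA).det_pos
  have hDeq : ∀ A, D A = inner ℝ (A a) (A a) * (inner ℝ (A x) (A x) * inner ℝ (A y) (A y)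
      - inner ℝ (A x) (A y) ^ 2) - inner ℝ (A a) (A x) * (inner ℝ (A a) (A x) * inner ℝ (A y) (A y)
      - inner ℝ (A x) (A y) * inner ℝ (A a) (A y)) + inner ℝ (A a) (A y) *
      (inner ℝ (A a) (A x) * inner ℝ (A x) (A y) - inner ℝ (A x) (A x) * inner ℝ (A a) (A y)) := by
    intro A
    simp only [hD, Matrix.det_fin_three, Matrix.of_apply, Matrix.cons_val, real_inner_comm (A a),
      real_inner_comm (A x) (A y)]
    ring
  have key : IsFormContinuous fun A => (volumeFactor A ^ 2 * D A * inner ℝ (A a) (A a)) /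
      √(volumeFactor A ^ 3 * D A ^ 2) := by
    refine IsFormContinuous.div ?_ (IsFormContinuous.comp ?_ Real.continuous_sqrt) fun A => ?_
    · convert hcof using 2 with A
      simp only [areaSq, hDeq]
      ring
    · convert hdet using 2 with A
      simp only [areaSq, hDeq, real_inner_comm (A a), real_inner_comm (A x) (A y)]
      ring
    · exact (Real.sqrt_pos.2 (mul_pos (pow_pos (volumeFactor_pos A) 3)
        (pow_pos (hD0 A) 2))).ne'
  convert key using 2 with A
  have hc := volumeFactor_pos A
  have h1 : √(volumeFactor A ^ 3 * D A ^ 2) = volumeFactor A * √(volumeFactor A) * D A := by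
    rw [show volumeFactor A ^ 3 * D A ^ 2 = volumeFactor A * (volumeFactor A * D A) ^ 2 by ring,
      Real.sqrt_mul hc.le, Real.sqrt_sq (mul_pos hc (hD0 A)).le]
    ring
  have h2 : √(volumeFactor A) ≠ 0 := (Real.sqrt_pos.2 hc).ne'
  have h3 := Real.mul_self_sqrt hc.le
  have h4 := (hD0 A).ne'
  rw [h1, eq_div_iff (by positivity)]
  linear_combination (volumeFactor A * D A * inner ℝ (A a) (A a)) * h3

theorem isFormContinuous_sqrt_mul_inner (a b : EuclideanSpace ℝ (Fin 8)) :
    IsFormContinuous fun A => √(volumeFactor A) * inner ℝ (A a) (A b) := by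
  convert (IsFormContinuous.const (1 / 2)).mul
    (((isFormContinuous_sqrt_mul_inner_self (a + b)).sub
    (isFormContinuous_sqrt_mul_inner_self a)).sub (isFormContinuous_sqrt_mul_inner_self b))
    using 2 with A
  simp only [map_add, inner_add_left, inner_add_right, real_inner_comm (A a) (A b)]
  ring

/-- The determinant of the `8 × 8` Gram matrix scaled by `√c` is `c ^ 4 * c ^ 2`, for the volume
factor `c`. -/
theorem isFormContinuous_sqrt_volumeFactor :
    IsFormContinuous fun A => √(volumeFactor A) := by
  have h := ((IsFormContinuous.det (k := 8) (fun i j => isFormContinuous_sqrt_mul_inner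
    (EuclideanSpace.basisFun (Fin 8) ℝ i) (EuclideanSpace.basisFun (Fin 8) ℝ j))).comp
    (Real.continuous_rpow_const (q := 1 / 12) (by norm_num)))
  convert h using 2 with A
  have hc := volumeFactor_pos A
  set e := EuclideanSpace.basisFun (Fin 8) ℝ
  set W : Matrix (Fin 8) (Fin 8) ℝ := Matrix.of fun i k => A (e i) k with hW
  have h1 : (Matrix.of fun i j => √(volumeFactor A) * inner ℝ (A (e i)) (A (e j)) :
      Matrix (Fin 8) (Fin 8) ℝ) = √(volumeFactor A) • (W * W.transpose) := by
    ext i j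
    simp [hW, Matrix.mul_apply, PiLp.inner_apply, mul_comm]
  have h2 : W.det = LinearMap.det
      (A : EuclideanSpace ℝ (Fin 8) →ₗ[ℝ] EuclideanSpace ℝ (Fin 8)) := by
    rw [hW, det_coord_map]
    have : (Matrix.of fun i k => e i k : Matrix (Fin 8) (Fin 8) ℝ) = 1 := by
      ext i j
      simp [e, Matrix.one_apply, eq_comm]
    rw [this, Matrix.det_one, mul_one]
  have h3 : W.det * W.det = volumeFactor A ^ 2 := by
    rw [h2, volumeFactor, sq_abs, sq]
  rw [h1, Matrix.det_smul, Matrix.det_mul, Matrix.det_transpose, h3, Fintype.card_fin]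
  have h4 : √(volumeFactor A) ^ 8 * volumeFactor A ^ 2 = √(volumeFactor A) ^ 12 := by
    nth_rewrite 2 [← Real.sq_sqrt hc.le]
    ring
  rw [h4, ← Real.rpow_natCast, ← Real.rpow_mul (Real.sqrt_nonneg _)]
  norm_num

/-- The Euclidean metric pulled back by `A` is a continuous function of the form `A^* Φ₀`. -/
theorem isFormContinuous_inner (a b : EuclideanSpace ℝ (Fin 8)) :
    IsFormContinuous fun A => inner ℝ (A a) (A b) := by
  convert (isFormContinuous_sqrt_mul_inner a b).div isFormContinuous_sqrt_volumeFactor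
    (fun A => (Real.sqrt_pos.2 (volumeFactor_pos A)).ne') using 2 with A
  have := (Real.sqrt_pos.2 (volumeFactor_pos A)).ne'
  field_simp

/-! ### Closedness of the form and continuity of the metric on the manifold -/

section Forms

variable {M : Type*} [TopologicalSpace M] [ChartedSpace (EuclideanSpace ℝ (Fin 8)) M]

theorem contDiffAt_formInChart (Φ : Spin7Structure M) (x₀ : M)
    {u : EuclideanSpace ℝ (Fin 8)} (hu : u ∈ (extChartAt (𝓡 8) x₀).target) :
    ContDiffAt ℝ ∞ (formInChart Φ.form x₀) u :=
  (Φ.smooth x₀).contDiffAt ((isOpen_extChartAt_target x₀).mem_nhds hu)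

/-- A form that is parallel for a connection without torsion is closed. -/
theorem Spin7Structure.IsTorsionFree.extDeriv_formInChart {Φ : Spin7Structure M}
    (hΦ : Φ.IsTorsionFree) (x₀ : M) {u : EuclideanSpace ℝ (Fin 8)}
    (hu : u ∈ (extChartAt (𝓡 8) x₀).target) : extDeriv (formInChart Φ.form x₀) u = 0 := by
  obtain ⟨Γ, ⟨hsymm, -⟩, hpar⟩ := hΦ x₀ u hu
  have hd : DifferentiableAt ℝ (formInChart Φ.form x₀) u :=
    (contDiffAt_formInChart Φ x₀ hu).differentiableAt (by simp)
  set Γ' : EuclideanSpace ℝ (Fin 8) →L[ℝ] EuclideanSpace ℝ (Fin 8) →L[ℝ]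
      EuclideanSpace ℝ (Fin 8) :=
    LinearMap.toContinuousLinearMap
      ((LinearMap.toContinuousLinearMap (𝕜 := ℝ) (E := EuclideanSpace ℝ (Fin 8))
        (F' := EuclideanSpace ℝ (Fin 8))).toLinearMap ∘ₗ Γ) with hΓ'
  have hΓ'a : ∀ v w, Γ' v w = Γ v w := fun v w => rfl
  have h := ContinuousAlternatingMap.alternatizeUncurryFin_fderivCompContinuousLinearMap_eq_zero
    (formInChart Φ.form x₀ u) (.id ℝ _) (h := Γ') (fun x y => hsymm x y)
  rw [extDeriv, ← h]
  congr 1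
  ext v a
  have h1 := hpar v a
  rw [sub_eq_zero] at h1
  rw [← fderiv_continuousAlternatingMap_apply_const_apply hd, h1]
  simp only [ContinuousLinearMap.comp_apply,
    ContinuousAlternatingMap.fderivCompContinuousLinearMap_apply]
  refine Finset.sum_congr rfl fun k _ => ?_
  congr 1
  ext1 i
  by_cases hik : i = k
  · subst hik; simp [hΓ'a]
  · simp [Function.update_of_ne hik]

/-- The Cayley inequality: `Φ` is a calibration. -/
theorem Spin7Structure.abs_form_le_gramVolume (Φ : Spin7Structure M) (x : M)
    (v : Fin 4 → TangentSpace (𝓡 8) x) : |Φ.form x v| ≤ Φ.gramVolume x v := by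
  apply Real.abs_le_sqrt
  rw [← (Φ.exists_iso x).choose_spec]
  exact cayleyForm₀_sq_le fun k => Φ.frame x (v k)

theorem continuousWithinAt_formInChart (Φ : Spin7Structure M) {Z : Type*} [TopologicalSpace Z]
    {p : Z → M} {s : Set Z} {z₀ : Z} (hp : ContinuousWithinAt p s z₀) :
    ContinuousWithinAt (fun z => formInChart Φ.form (p z₀) (extChartAt (𝓡 8) (p z₀) (p z))) s z₀ :=
  ((contDiffAt_formInChart Φ (p z₀)
    (mem_extChartAt_target (p z₀))).continuousAt.comp (continuousAt_extChartAt (p z₀))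
    ).comp_continuousWithinAt hp

theorem eventually_mem_extChartAt_source {Z : Type*} [TopologicalSpace Z] {p : Z → M} {s : Set Z}
    {z₀ : Z} (hp : ContinuousWithinAt p s z₀) :
    ∀ᶠ z in 𝓝[s] z₀, p z ∈ (extChartAt (𝓡 8) (p z₀)).source :=
  hp (extChartAt_source_mem_nhds (p z₀))

/-- The derivative at `x` of the chart around `x₀`, as a map to the model space. -/
noncomputable def chartDeriv (x₀ x : M) : TangentSpace (𝓡 8) x →L[ℝ] EuclideanSpace ℝ (Fin 8) :=
  mfderiv (𝓡 8) 𝓘(ℝ, EuclideanSpace ℝ (Fin 8)) (extChartAt (𝓡 8) x₀) x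

variable [IsManifold (𝓡 8) ∞ M]

theorem mfderiv_symm_chartDeriv {x₀ x : M} (hx : x ∈ (extChartAt (𝓡 8) x₀).source)
    (v : TangentSpace (𝓡 8) x) :
    mfderiv 𝓘(ℝ, EuclideanSpace ℝ (Fin 8)) (𝓡 8) (extChartAt (𝓡 8) x₀).symm
      (extChartAt (𝓡 8) x₀ x) (chartDeriv x₀ x v) = v := by
  have : IsManifold (𝓡 8) 1 M := IsManifold.of_le (n := ∞) (by simp)
  have := mfderivWithin_extChartAt_symm_comp_mfderiv_extChartAt' (I := 𝓡 8) (x := x₀) hx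
  simp only [modelWithCornersSelf_coe, range_id, mfderivWithin_univ] at this
  exact DFunLike.congr_fun this v

theorem form_eq_formInChart (Φ : Spin7Structure M) {x₀ x : M}
    (hx : x ∈ (extChartAt (𝓡 8) x₀).source) (v : Fin 4 → TangentSpace (𝓡 8) x) :
    Φ.form x v = formInChart Φ.form x₀ (extChartAt (𝓡 8) x₀ x) fun k =>
      chartDeriv x₀ x (v k) := by
  have transport : ∀ y : M, y = x → ∀ w : Fin 4 → EuclideanSpace ℝ (Fin 8),
      Φ.form y w = Φ.form x w := by
    rintro y rfl w; rfl
  have h1 := transport _ ((extChartAt (𝓡 8) x₀).left_inv hx) v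
  rw [← h1]
  refine congrArg (Φ.form _) (funext fun k => ?_)
  exact (mfderiv_symm_chartDeriv hx (v k)).symm

/-- In a chart, the form and the metric are the pullbacks of `Φ₀` and the Euclidean metric under
the same linear automorphism of `ℝ⁸`. -/
theorem exists_pullbackForm_eq (Φ : Spin7Structure M) {x₀ x : M}
    (hx : x ∈ (extChartAt (𝓡 8) x₀).source) :
    ∃ A : EuclideanSpace ℝ (Fin 8) ≃L[ℝ] EuclideanSpace ℝ (Fin 8),
      formInChart Φ.form x₀ (extChartAt (𝓡 8) x₀ x) = pullbackForm A ∧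
      ∀ v w : TangentSpace (𝓡 8) x, Φ.metric x v w =
        inner ℝ (A (chartDeriv x₀ x v))
          (A (chartDeriv x₀ x w)) := by
  have : IsManifold (𝓡 8) 1 M := IsManifold.of_le (n := ∞) (by simp)
  obtain ⟨L, hL⟩ : ∃ L : TangentSpace (𝓡 8) x ≃L[ℝ] EuclideanSpace ℝ (Fin 8), ∀ v, L v =
      chartDeriv x₀ x v := by
    obtain ⟨L, hL⟩ := isInvertible_mfderiv_extChartAt (I := 𝓡 8) (x := x₀) hx
    exact ⟨L, fun v => DFunLike.congr_fun hL v⟩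
  have hA : ∀ v, (L.symm.trans (Φ.frame x)) (L v) = Φ.frame x v :=
    fun v => congrArg (Φ.frame x) (L.symm_apply_apply v)
  refine ⟨L.symm.trans (Φ.frame x), ?_, fun v w => ?_⟩
  · ext a
    have h := form_eq_formInChart Φ hx fun k => L.symm (a k)
    have h2 : (fun k => (chartDeriv x₀ x
        (L.symm (a k)) : EuclideanSpace ℝ (Fin 8))) = a := by
      ext1 k
      exact (hL _).symm.trans (L.apply_symm_apply (a k))
    have h3 := h.trans (congrArg (formInChart Φ.form x₀ (extChartAt (𝓡 8) x₀ x)) h2)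
    rw [← h3, ← (Φ.exists_iso x).choose_spec]
    rfl
  · have e : ∀ v, (L.symm.trans (Φ.frame x)) (chartDeriv x₀ x v : EuclideanSpace ℝ (Fin 8)) =
        Φ.frame x v :=
      fun v => (congrArg (L.symm.trans (Φ.frame x)) (hL v).symm).trans (hA v)
    exact (congrArg₂ (inner ℝ) (e v) (e w)).symm

variable {Z : Type*} [TopologicalSpace Z] {p : Z → M} {s : Set Z} {z₀ : Z}

theorem continuousWithinAt_chartDeriv {w : ∀ z, TangentSpace (𝓡 8) (p z)}
    (hw : ContinuousWithinAt (fun z => (⟨p z, w z⟩ : TangentBundle (𝓡 8) M)) s z₀) :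
    ContinuousWithinAt
      (fun z => chartDeriv (p z₀) (p z) (w z) : Z → EuclideanSpace ℝ (Fin 8)) s z₀ := by
  have : IsManifold (𝓡 8) 1 M := IsManifold.of_le (n := ∞) (by simp)
  obtain ⟨h1, h2⟩ := (FiberBundle.continuousWithinAt_totalSpace _ _).1 hw
  have key : ∀ z, p z ∈ (chartAt (EuclideanSpace ℝ (Fin 8)) (p z₀)).source →
      chartDeriv (p z₀) (p z) (w z) =
      ((trivializationAt (EuclideanSpace ℝ (Fin 8)) (TangentSpace (𝓡 8)) (p z₀))
        (⟨p z, w z⟩ : TangentBundle (𝓡 8) M)).2 := by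
    intro z hz
    refine (DFunLike.congr_fun (TangentBundle.continuousLinearMapAt_trivializationAt hz)
      (w z)).symm.trans ?_
    refine Bundle.Trivialization.continuousLinearMapAt_apply_of_mem (R := ℝ) _ ?_ (w z)
    simpa using hz
  refine h2.congr_of_eventuallyEq ?_ (key z₀ (mem_chart_source _ _))
  filter_upwards [h1 ((chartAt (EuclideanSpace ℝ (Fin 8)) (p z₀)).open_source.mem_nhds
    (mem_chart_source _ _))] with z hz using key z hz

theorem Spin7Structure.continuousWithinAt_form (Φ : Spin7Structure M)
    {w : Fin 4 → ∀ z, TangentSpace (𝓡 8) (p z)}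
    (hw : ∀ k, ContinuousWithinAt (fun z => (⟨p z, w k z⟩ : TangentBundle (𝓡 8) M)) s z₀) :
    ContinuousWithinAt (fun z => Φ.form (p z) fun k => w k z) s z₀ := by
  have hp : ContinuousWithinAt p s z₀ :=
    ((FiberBundle.continuousWithinAt_totalSpace _ _).1 (hw 0)).1
  have h1 := continuousWithinAt_formInChart Φ hp
  have h2 := continuousWithinAt_pi.2 fun k => continuousWithinAt_chartDeriv (w := w k) (hw k)
  have h3 := ContinuousEval.continuous_eval (F := EuclideanSpace ℝ (Fin 8) [⋀^Fin 4]→L[ℝ] ℝ)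
    |>.continuousAt.comp_continuousWithinAt (h1.prodMk h2)
  refine h3.congr_of_eventuallyEq ?_ (form_eq_formInChart Φ (mem_extChartAt_source _) _)
  filter_upwards [eventually_mem_extChartAt_source hp] with z hz
  exact form_eq_formInChart Φ hz _

/-- The metric is continuous: in a chart, its coefficients are continuous functions of those of the
form. -/
theorem Spin7Structure.continuousWithinAt_metric (Φ : Spin7Structure M)
    {v w : ∀ z, TangentSpace (𝓡 8) (p z)}
    (hv : ContinuousWithinAt (fun z => (⟨p z, v z⟩ : TangentBundle (𝓡 8) M)) s z₀)
    (hw : ContinuousWithinAt (fun z => (⟨p z, w z⟩ : TangentBundle (𝓡 8) M)) s z₀) :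
    ContinuousWithinAt (fun z => Φ.metric (p z) (v z) (w z)) s z₀ := by
  have hp : ContinuousWithinAt p s z₀ := ((FiberBundle.continuousWithinAt_totalSpace _ _).1 hv).1
  have h1 := continuousWithinAt_formInChart Φ hp
  have hv' := continuousWithinAt_chartDeriv hv
  have hw' := continuousWithinAt_chartDeriv hw
  set e := fun i : Fin 8 => (EuclideanSpace.single i 1 : EuclideanSpace ℝ (Fin 8)) with he
  choose G hGc hG using fun i j => isFormContinuous_inner (e i) (e j)
  have key : ∀ z, p z ∈ (extChartAt (𝓡 8) (p z₀)).source → Φ.metric (p z) (v z) (w z) =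
      ∑ i, ∑ j, chartDeriv (p z₀) (p z) (v z) i *
        chartDeriv (p z₀) (p z) (w z) j *
        G i j (formInChart Φ.form (p z₀) (extChartAt (𝓡 8) (p z₀) (p z))) := by
    intro z hz
    obtain ⟨A, hA, hm⟩ := exists_pullbackForm_eq Φ hz
    have expand : ∀ a : EuclideanSpace ℝ (Fin 8), a = ∑ i, a i • e i := by
      intro a
      have := (EuclideanSpace.basisFun (Fin 8) ℝ).sum_repr a
      simpa [he] using this.symm
    rw [hm, hA]
    simp only [hG]
    generalize chartDeriv (p z₀) (p z) (v z) = a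
    generalize chartDeriv (p z₀) (p z) (w z) = b
    conv_lhs => rw [expand a, expand b]
    simp only [map_sum, map_smul, sum_inner, inner_sum, inner_smul_left, inner_smul_right,
      RCLike.conj_to_real, Finset.mul_sum]
    rw [Finset.sum_comm]
    refine Finset.sum_congr rfl fun i _ => Finset.sum_congr rfl fun j _ => ?_
    ring
  have hsum : ContinuousWithinAt (fun z => ∑ i, ∑ j, chartDeriv (p z₀) (p z) (v z) i *
        chartDeriv (p z₀) (p z) (w z) j *
        G i j (formInChart Φ.form (p z₀) (extChartAt (𝓡 8) (p z₀) (p z)))) s z₀ := by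
    refine tendsto_finsetSum _ fun i _ => tendsto_finsetSum _ fun j _ => ?_
    have hG' : ContinuousWithinAt (fun z =>
        G i j (formInChart Φ.form (p z₀) (extChartAt (𝓡 8) (p z₀) (p z)))) s z₀ := by
      obtain ⟨A₀, hA₀, -⟩ := exists_pullbackForm_eq Φ (mem_extChartAt_source (I := 𝓡 8) (p z₀))
      refine (hGc i j _ ⟨A₀, hA₀.symm⟩).tendsto.comp (tendsto_nhdsWithin_iff.2 ⟨h1, ?_⟩)
      filter_upwards [eventually_mem_extChartAt_source hp] with z hz
      obtain ⟨A, hA, -⟩ := exists_pullbackForm_eq Φ hz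
      exact ⟨A, hA.symm⟩
    have c : ∀ k : Fin 8, Continuous fun a : EuclideanSpace ℝ (Fin 8) => a k := by fun_prop
    exact (((c i).continuousAt.comp_continuousWithinAt hv').mul
      ((c j).continuousAt.comp_continuousWithinAt hw')).mul hG'
  refine hsum.congr_of_eventuallyEq ?_ (key z₀ (mem_extChartAt_source _))
  filter_upwards [eventually_mem_extChartAt_source hp] with z hz
  exact key z hz

theorem Spin7Structure.continuousWithinAt_gramVolume (Φ : Spin7Structure M)
    {w : Fin 4 → ∀ z, TangentSpace (𝓡 8) (p z)}
    (hw : ∀ k, ContinuousWithinAt (fun z => (⟨p z, w k z⟩ : TangentBundle (𝓡 8) M)) s z₀) :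
    ContinuousWithinAt (fun z => Φ.gramVolume (p z) fun k => w k z) s z₀ := by
  have h : ContinuousWithinAt (fun z i j => Φ.metric (p z) (w i z) (w j z)) s z₀ :=
    continuousWithinAt_pi.2 fun i => continuousWithinAt_pi.2 fun j =>
      Φ.continuousWithinAt_metric (hw i) (hw j)
  exact (Real.continuous_sqrt.comp (Continuous.matrix_det continuous_id)
    ).continuousAt.comp_continuousWithinAt h

end Forms

/-! ### Stokes' theorem on the standard simplex -/

theorem isClosed_stdCorner (n : ℕ) : IsClosed (stdCorner n) := by
  have : stdCorner n = (⋂ i, {a : Fin n → ℝ | 0 ≤ a i}) ∩ {a | ∑ i, a i ≤ 1} := by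
    ext a; simp [stdCorner]
  rw [this]
  exact (isClosed_iInter fun i => isClosed_le continuous_const (continuous_apply i)).inter
    (isClosed_le (by fun_prop) continuous_const)

theorem stdCorner_subset_Icc (n : ℕ) : stdCorner n ⊆ Icc 0 1 := fun _ ha =>
  ⟨fun i => ha.1 i, fun i =>
    (Finset.single_le_sum (fun j _ => ha.1 j) (Finset.mem_univ i)).trans ha.2⟩

theorem isCompact_stdCorner (n : ℕ) : IsCompact (stdCorner n) :=
  isCompact_Icc.of_isClosed_subset (isClosed_stdCorner n) (stdCorner_subset_Icc n)

theorem convex_stdCorner (n : ℕ) : Convex ℝ (stdCorner n) := by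
  intro a ha b hb s t hs ht hst
  refine ⟨fun i => ?_, ?_⟩
  · have := mul_nonneg hs (ha.1 i)
    have := mul_nonneg ht (hb.1 i)
    simp only [Pi.add_apply, Pi.smul_apply, smul_eq_mul]
    linarith
  · simp only [Pi.add_apply, Pi.smul_apply, smul_eq_mul, Finset.sum_add_distrib, ← Finset.mul_sum]
    nlinarith [ha.2, hb.2]

theorem volume_stdCorner_diff_interior (n : ℕ) :
    volume (stdCorner n \ interior (stdCorner n)) = 0 := by
  have h := (convex_stdCorner n).addHaar_frontier volume
  rwa [frontier, (isClosed_stdCorner n).closure_eq] at h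

theorem interior_ae_eq_stdCorner (n : ℕ) :
    interior (stdCorner n) =ᵐ[volume] stdCorner n := by
  refine (interior_subset.eventuallyLE).antisymm ?_
  exact ae_le_set.2 (volume_stdCorner_diff_interior n)

theorem faceMap_zero (n : ℕ) (a : Fin n → ℝ) :
    faceMap 0 a = (Fin.cons (1 - ∑ i, a i) a : Fin (n + 1) → ℝ) := by
  ext j
  simp [faceMap]

theorem faceMap_succ {n : ℕ} (i : Fin (n + 1)) (a : Fin n → ℝ) :
    faceMap i.succ a = (i.insertNth (0 : ℝ) a : Fin (n + 1) → ℝ) := by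
  ext j
  simp only [faceMap]
  refine Fin.succAboveCases i ?_ (fun l => ?_) j
  · simp
  · rw [Fin.insertNth_apply_succAbove, ← Fin.succ_succAbove_succ, Fin.insertNth_apply_succAbove,
      Fin.cons_succ]

theorem sum_insertNth {n : ℕ} (i : Fin (n + 1)) (s : ℝ) (a : Fin n → ℝ) :
    ∑ j, (i.insertNth s a : Fin (n + 1) → ℝ) j = s + ∑ j, a j := by
  rw [Fin.sum_univ_succAbove _ i]; simp

theorem insertNth_mem_stdCorner_iff {n : ℕ} (i : Fin (n + 1)) (s : ℝ) (a : Fin n → ℝ) :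
    (i.insertNth s a : Fin (n + 1) → ℝ) ∈ stdCorner (n + 1) ↔
      a ∈ stdCorner n ∧ s ∈ Icc 0 (1 - ∑ j, a j) := by
  have h : (∀ j, 0 ≤ (i.insertNth s a : Fin (n + 1) → ℝ) j) ↔ 0 ≤ s ∧ ∀ j, 0 ≤ a j := by
    rw [Fin.forall_iff_succAbove i]; simp
  simp only [stdCorner, mem_ofPred_eq, h, sum_insertNth, mem_Icc]
  constructor
  · rintro ⟨⟨h1, h2⟩, h3⟩; exact ⟨⟨h2, by linarith⟩, h1, by linarith⟩
  · rintro ⟨⟨h1, h2⟩, h3, h4⟩; exact ⟨⟨h3, h1⟩, by linarith⟩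

/-- Fubini's theorem on the simplex, along the `i`-th coordinate. -/
theorem setIntegral_stdCorner_succ {n : ℕ} (i : Fin (n + 1)) (g : (Fin (n + 1) → ℝ) → ℝ)
    (hg : IntegrableOn g (stdCorner (n + 1))) :
    ∫ x in stdCorner (n + 1), g x =
      ∫ a in stdCorner n, ∫ s in Icc 0 (1 - ∑ j, a j), g (i.insertNth s a) := by
  have hmp := (volume_preserving_piFinSuccAbove (fun _ : Fin (n + 1) => ℝ) i).symm
  set G : (Fin (n + 1) → ℝ) → ℝ := (stdCorner (n + 1)).indicator g with hG
  have hms := (isClosed_stdCorner (n + 1)).measurableSet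
  have hGi : Integrable G := (integrable_indicator_iff hms).2 hg
  rw [← integral_indicator hms]
  change ∫ x, G x = _
  rw [← hmp.integral_comp (MeasurableEquiv.measurableEmbedding _)]
  rw [Measure.volume_eq_prod, integral_prod_symm _
    (by rw [← Measure.volume_eq_prod]; exact hmp.integrable_comp_of_integrable hGi),
    ← integral_indicator (isClosed_stdCorner n).measurableSet]
  refine integral_congr_ae (Filter.Eventually.of_forall fun a => ?_)
  have happ : ∀ s : ℝ, (MeasurableEquiv.piFinSuccAbove (fun _ : Fin (n + 1) => ℝ) i).symm (s, a) =
      (i.insertNth s a : Fin (n + 1) → ℝ) := fun s => rfl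
  simp only [happ]
  by_cases ha : a ∈ stdCorner n
  · rw [indicator_of_mem ha, ← integral_indicator measurableSet_Icc]
    refine integral_congr_ae (Filter.Eventually.of_forall fun s => ?_)
    simp only [hG, indicator, insertNth_mem_stdCorner_iff, ha, true_and]
  · rw [indicator_of_notMem ha]
    simp [hG, insertNth_mem_stdCorner_iff, ha]

theorem measurePreserving_one_sub_sum (n : ℕ) :
    MeasurePreserving (fun p : ℝ × (Fin n → ℝ) => (1 - (p.1 + ∑ j, p.2 j), p.2)) := by
  have h := MeasurePreserving.skew_product (MeasurePreserving.id (volume : Measure (Fin n → ℝ)))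
    (g := fun (b : Fin n → ℝ) (x : ℝ) => 1 - (x + ∑ j, b j)) (μc := (volume : Measure ℝ))
    (μd := (volume : Measure ℝ)) (by fun_prop) (Filter.Eventually.of_forall fun b => by
      have := Measure.measurePreserving_sub_left (volume : Measure ℝ) (1 - ∑ j, b j)
      convert this.map_eq using 2
      ext x; ring)
  have hs := Measure.measurePreserving_swap (μ := (volume : Measure ℝ))
    (ν := (volume : Measure (Fin n → ℝ)))
  have hs' := Measure.measurePreserving_swap (μ := (volume : Measure (Fin n → ℝ)))
    (ν := (volume : Measure ℝ))
  exact hs'.comp (h.comp hs)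

/-- The parametrizations of the face opposite to the origin that forget the `i`-th, respectively the
first, coordinate differ by a measure preserving map. -/
theorem exists_measurePreserving_faceMap_zero {n : ℕ} (i : Fin (n + 1)) :
    ∃ T : (Fin n → ℝ) → (Fin n → ℝ), MeasurePreserving T ∧
      ∀ a, faceMap 0 (T a) = (i.insertNth (1 - ∑ j, a j) a : Fin (n + 1) → ℝ) := by
  refine Fin.cases ?_ (fun k => ?_) i
  · refine ⟨id, MeasurePreserving.id _, fun a => ?_⟩
    rw [faceMap_zero, id, Fin.insertNth_zero']
  · cases n with
    | zero => exact k.elim0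
    | succ n =>
      have h0 := volume_preserving_piFinSuccAbove (fun _ : Fin (n + 1) => ℝ) 0
      have hk := (volume_preserving_piFinSuccAbove (fun _ : Fin (n + 1) => ℝ) k).symm
      refine ⟨fun a => k.insertNth (1 - (a 0 + ∑ j : Fin n, a j.succ)) (Fin.tail a),
        hk.comp ((measurePreserving_one_sub_sum n).comp h0), fun a => ?_⟩
      have e : ∑ j, a j = a 0 + ∑ j : Fin n, a j.succ := Fin.sum_univ_succ a
      have e' : ∑ j, Fin.tail a j = ∑ j : Fin n, a j.succ := rfl
      conv_rhs => rw [← Fin.cons_self_tail a, Fin.insertNth_succ_cons]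
      rw [faceMap_zero, Fin.cons_self_tail, sum_insertNth, e, e']
      congr 1
      ring

/-- Integrals over the face opposite to the origin do not depend on the coordinate that is used as a
function of the others to parametrize it. -/
theorem setIntegral_stdCorner_topFace {n : ℕ} (i : Fin (n + 1)) (h : (Fin (n + 1) → ℝ) → ℝ)
    (hh : ContinuousOn h (stdCorner (n + 1))) :
    ∫ a in stdCorner n, h (i.insertNth (1 - ∑ j, a j) a) =
      ∫ a in stdCorner n, h (faceMap 0 a) := by
  obtain ⟨T, hT, hTf⟩ := exists_measurePreserving_faceMap_zero i
  have hpre : T ⁻¹' stdCorner n = stdCorner n := by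
    ext a
    have h1 : T a ∈ stdCorner n ↔ faceMap 0 (T a) ∈ stdCorner (n + 1) := by
      rw [faceMap_zero, ← Fin.insertNth_zero', insertNth_mem_stdCorner_iff]
      simp only [mem_Icc, sub_nonneg, le_refl, and_true, iff_self_and]
      exact fun hT => hT.2
    rw [mem_preimage, h1, hTf, insertNth_mem_stdCorner_iff]
    simp only [mem_Icc, sub_nonneg, le_refl, and_true, and_iff_left_iff_imp]
    exact fun ha => ha.2
  have hm : AEStronglyMeasurable (fun a => h (faceMap 0 a)) (volume.restrict (stdCorner n)) :=
    (hh.comp (contDiff_faceMap 0).continuous.continuousOn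
      (fun a ha => faceMap_mem 0 ha)).aestronglyMeasurable (isClosed_stdCorner n).measurableSet
  have hr := hT.restrict_preimage (isClosed_stdCorner n).measurableSet
  rw [hpre] at hr
  rw [← hr.map_eq] at hm
  have := integral_map hr.measurable.aemeasurable hm
  rw [hr.map_eq] at this
  rw [this]
  simp only [hTf]

theorem hasDerivAt_insertNth {n : ℕ} (i : Fin (n + 1)) (a : Fin n → ℝ) (s : ℝ) :
    HasDerivAt (fun s : ℝ => (i.insertNth s a : Fin (n + 1) → ℝ)) (Pi.single i (1 : ℝ)) s := by
  rw [hasDerivAt_pi]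
  intro j
  refine Fin.succAboveCases i ?_ (fun l => ?_) j
  · simpa using hasDerivAt_id' s
  · simpa using hasDerivAt_const s (a l)

theorem continuous_insertNth_const {n : ℕ} (i : Fin (n + 1)) (a : Fin n → ℝ) :
    Continuous fun s : ℝ => (i.insertNth s a : Fin (n + 1) → ℝ) :=
  continuous_iff_continuousAt.2 fun s => (hasDerivAt_insertNth i a s).continuousAt

/-- The divergence theorem on the simplex. -/
theorem setIntegral_divergence_stdCorner {n : ℕ} (F : Fin (n + 1) → (Fin (n + 1) → ℝ) → ℝ)
    {U : Set (Fin (n + 1) → ℝ)} (hU : IsOpen U) (hΔ : stdCorner (n + 1) ⊆ U)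
    (hF : ∀ i, ContDiffOn ℝ 1 (F i) U) :
    ∫ x in stdCorner (n + 1), ∑ i, fderiv ℝ (F i) x (Pi.single i 1) =
      ∑ i, ((∫ a in stdCorner n, F i (faceMap 0 a)) -
        ∫ a in stdCorner n, F i (faceMap i.succ a)) := by
  have hc : ∀ i, ContinuousOn (fun x => fderiv ℝ (F i) x (Pi.single i 1)) U := fun i =>
    ((hF i).continuousOn_fderiv_of_isOpen hU le_rfl).clm_apply continuousOn_const
  have hi : ∀ i, IntegrableOn (fun x => fderiv ℝ (F i) x (Pi.single i 1)) (stdCorner (n + 1)) :=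
    fun i => ((hc i).mono hΔ).integrableOn_compact (isCompact_stdCorner _)
  rw [integral_finsetSum _ fun i _ => hi i]
  refine Finset.sum_congr rfl fun i _ => ?_
  have hFc : ContinuousOn (F i) (stdCorner (n + 1)) := (hF i).continuousOn.mono hΔ
  have hface : ∀ k : Fin (n + 2), IntegrableOn (fun a => F i (faceMap k a)) (stdCorner n) :=
    fun k => (hFc.comp (contDiff_faceMap k).continuous.continuousOn
      fun a ha => faceMap_mem k ha).integrableOn_compact (isCompact_stdCorner _)
  rw [setIntegral_stdCorner_succ i _ (hi i), ← setIntegral_stdCorner_topFace i _ hFc,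
    ← integral_sub _ (hface _)]
  · refine setIntegral_congr_fun (isClosed_stdCorner n).measurableSet fun a ha => ?_
    have hle : (0 : ℝ) ≤ 1 - ∑ j, a j := sub_nonneg.2 ha.2
    have hmem : ∀ s ∈ Icc (0 : ℝ) (1 - ∑ j, a j),
        (i.insertNth s a : Fin (n + 1) → ℝ) ∈ stdCorner (n + 1) := fun s hs =>
      (insertNth_mem_stdCorner_iff i s a).2 ⟨ha, hs⟩
    simp only [faceMap_succ]
    rw [integral_Icc_eq_integral_Ioc, ← intervalIntegral.integral_of_le hle]
    refine intervalIntegral.integral_eq_sub_of_hasDerivAt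
      (f := fun s => F i (i.insertNth s a)) (fun s hs => ?_) ?_
    · rw [uIcc_of_le hle] at hs
      have hd := ((hF i).contDiffAt (hU.mem_nhds (hΔ (hmem s hs)))).differentiableAt
        one_ne_zero
      exact hd.hasFDerivAt.comp_hasDerivAt s (hasDerivAt_insertNth i a s)
    · refine ContinuousOn.intervalIntegrable ?_
      rw [uIcc_of_le hle]
      exact ((hc i).mono hΔ).comp (continuous_insertNth_const i a).continuousOn hmem
  · have hcont : Continuous fun a : Fin n → ℝ =>
        (i.insertNth (1 - ∑ j, a j) a : Fin (n + 1) → ℝ) := by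
      refine continuous_pi fun j => ?_
      refine Fin.succAboveCases i ?_ (fun l => ?_) j
      · simp only [Fin.insertNth_apply_same]; fun_prop
      · simp only [Fin.insertNth_apply_succAbove]; fun_prop
    refine (hFc.comp hcont.continuousOn fun a ha => ?_).integrableOn_compact
      (isCompact_stdCorner _)
    exact (insertNth_mem_stdCorner_iff i _ a).2 ⟨ha, sub_nonneg.2 ha.2, le_rfl⟩

/-! ### Pullbacks of the form -/

theorem contDiffAt_compContinuousLinearMap_apply {E E' : Type*} [NormedAddCommGroup E]
    [NormedSpace ℝ E] [NormedAddCommGroup E'] [NormedSpace ℝ E'] {k : ℕ} {n : ℕ∞ω}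
    {η : E → E' [⋀^Fin k]→L[ℝ] ℝ} {L : E → E →L[ℝ] E'} {t : E}
    (hη : ContDiffAt ℝ n η t) (hL : ContDiffAt ℝ n L t) (a : Fin k → E) :
    ContDiffAt ℝ n (fun s => (η s).compContinuousLinearMap (L s) a) t := by
  have h1 : ContDiffAt ℝ n (fun s => (ContinuousMultilinearMap.apply ℝ (fun _ : Fin k => E) ℝ a)
      ((ContinuousMultilinearMap.compContinuousLinearMapContinuousMultilinear ℝ
        (fun _ : Fin k => E) (fun _ : Fin k => E') ℝ (fun _ => L s))
        (ContinuousAlternatingMap.toContinuousMultilinearMapLI (𝕜 := ℝ) (E := E') (F := ℝ)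
          (ι := Fin k) (η s)))) t := by
    refine (ContinuousLinearMap.contDiff _).contDiffAt.comp t (ContDiffAt.clm_apply ?_ ?_)
    · exact (ContinuousMultilinearMap.contDiff _).contDiffAt.comp t (contDiffAt_pi.2 fun _ => hL)
    · exact (LinearIsometry.contDiff _).contDiffAt.comp t hη
  exact h1

section Pullback

variable {M : Type*} [TopologicalSpace M] [ChartedSpace (EuclideanSpace ℝ (Fin 8)) M]
  {E : Type*} [NormedAddCommGroup E] [NormedSpace ℝ E]

/-- The pullback of `Φ` under a map from a vector space to the manifold. -/
noncomputable def Spin7Structure.pullback (Φ : Spin7Structure M) (f : E → M) (t : E) :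
    E [⋀^Fin 4]→L[ℝ] ℝ :=
  (Φ.form (f t)).compContinuousLinearMap (mfderiv 𝓘(ℝ, E) (𝓡 8) f t)

theorem Spin7Structure.pullback_apply (Φ : Spin7Structure M) (f : E → M) (t : E) (a : Fin 4 → E) :
    Φ.pullback f t a = Φ.form (f t) fun k => mfderiv 𝓘(ℝ, E) (𝓡 8) f t (a k) := rfl

theorem Spin7Structure.pullback_congr (Φ : Spin7Structure M) {f g : E → M} {t : E}
    (h : f =ᶠ[𝓝 t] g) : Φ.pullback f t = Φ.pullback g t := by
  have transport : ∀ y x : M, y = x → ∀ w : Fin 4 → EuclideanSpace ℝ (Fin 8),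
      Φ.form y w = Φ.form x w := by
    rintro y x rfl w; rfl
  ext a
  refine (transport _ _ h.eq_of_nhds _).trans ?_
  refine congrArg (Φ.form (g t)) (funext fun k => ?_)
  exact DFunLike.congr_fun (h.mfderiv_eq (I := 𝓘(ℝ, E)) (I' := 𝓡 8)) (a k)

theorem Spin7Structure.pullback_comp (Φ : Spin7Structure M) {E' : Type*} [NormedAddCommGroup E']
    [NormedSpace ℝ E'] {f : E → M} {g : E' → E} {t : E'}
    (hf : MDifferentiableAt 𝓘(ℝ, E) (𝓡 8) f (g t)) (hg : DifferentiableAt ℝ g t) :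
    Φ.pullback (f ∘ g) t = (Φ.pullback f (g t)).compContinuousLinearMap (fderiv ℝ g t) := by
  ext a
  refine congrArg (Φ.form (f (g t))) (funext fun k => ?_)
  have := mfderiv_comp (I := 𝓘(ℝ, E')) (I' := 𝓘(ℝ, E)) (I'' := 𝓡 8) t hf hg.mdifferentiableAt
  rw [mfderiv_eq_fderiv] at this
  exact DFunLike.congr_fun this (a k)

theorem contDiffAt_extChartAt_comp {f : E → M} {t₀ : E} (hf : ContMDiffAt 𝓘(ℝ, E) (𝓡 8) ∞ f t₀) :
    ContDiffAt ℝ ∞ (fun t => extChartAt (𝓡 8) (f t₀) (f t)) t₀ :=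
  contMDiffAt_iff_contDiffAt.1 ((contMDiffAt_extChartAt (x := f t₀)).comp t₀ hf)

variable [IsManifold (𝓡 8) ∞ M]

/-- Near a point, the pullback of `Φ` is the pullback of its expression in a chart. -/
theorem Spin7Structure.pullback_eventuallyEq (Φ : Spin7Structure M) {f : E → M} {U : Set E}
    (hU : IsOpen U) (hf : ContMDiffOn 𝓘(ℝ, E) (𝓡 8) ∞ f U) {t₀ : E} (ht₀ : t₀ ∈ U) :
    ∀ᶠ t in 𝓝 t₀, Φ.pullback f t =
      (formInChart Φ.form (f t₀) (extChartAt (𝓡 8) (f t₀) (f t))).compContinuousLinearMap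
        (fderiv ℝ (fun s => extChartAt (𝓡 8) (f t₀) (f s)) t) := by
  have hc := (hf.contMDiffAt (hU.mem_nhds ht₀)).continuousAt
  filter_upwards [hU.mem_nhds ht₀, hc (extChartAt_source_mem_nhds (I := 𝓡 8) (f t₀))] with t ht hs
  have hft : MDifferentiableAt 𝓘(ℝ, E) (𝓡 8) f t :=
    (hf.contMDiffAt (hU.mem_nhds ht)).mdifferentiableAt (by simp)
  have : IsManifold (𝓡 8) 1 M := IsManifold.of_le (n := ∞) (by simp)
  have he : MDifferentiableAt (𝓡 8) 𝓘(ℝ, EuclideanSpace ℝ (Fin 8)) (extChartAt (𝓡 8) (f t₀))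
      (f t) := mdifferentiableAt_extChartAt (by simpa using hs)
  have hcomp := mfderiv_comp t he hft
  ext a
  rw [Φ.pullback_apply, form_eq_formInChart Φ hs]
  refine congrArg (formInChart Φ.form (f t₀) (extChartAt (𝓡 8) (f t₀) (f t)))
    (funext fun k => ?_)
  have h2 : mfderiv 𝓘(ℝ, E) 𝓘(ℝ, EuclideanSpace ℝ (Fin 8)) (extChartAt (𝓡 8) (f t₀) ∘ f) t =
      fderiv ℝ (fun s => extChartAt (𝓡 8) (f t₀) (f s)) t := mfderiv_eq_fderiv
  exact (DFunLike.congr_fun hcomp (a k)).symm.trans (DFunLike.congr_fun h2 (a k))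

theorem Spin7Structure.contDiffAt_pullback_apply (Φ : Spin7Structure M) {f : E → M} {U : Set E}
    (hU : IsOpen U) (hf : ContMDiffOn 𝓘(ℝ, E) (𝓡 8) ∞ f U) {t₀ : E} (ht₀ : t₀ ∈ U)
    (a : Fin 4 → E) : ContDiffAt ℝ ∞ (fun t => Φ.pullback f t a) t₀ := by
  have hh := contDiffAt_extChartAt_comp (hf.contMDiffAt (hU.mem_nhds ht₀))
  refine ContDiffAt.congr_of_eventuallyEq ?_
    ((Φ.pullback_eventuallyEq hU hf ht₀).mono fun t ht => congrArg (fun η => η a) ht)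
  refine contDiffAt_compContinuousLinearMap_apply ?_ (hh.fderiv_right (m := ∞) (by simp)) a
  exact ContDiffAt.comp (f := fun t => extChartAt (𝓡 8) (f t₀) (f t)) t₀
    (contDiffAt_formInChart Φ (f t₀) (mem_extChartAt_target _)) hh

/-- Pullbacks of `Φ` are closed; the exterior derivative is written out on constant vector
fields. -/
theorem Spin7Structure.IsTorsionFree.sum_fderiv_pullback {Φ : Spin7Structure M}
    (hΦ : Φ.IsTorsionFree) {f : E → M} {U : Set E} (hU : IsOpen U)
    (hf : ContMDiffOn 𝓘(ℝ, E) (𝓡 8) ∞ f U) {t₀ : E} (ht₀ : t₀ ∈ U) (v : Fin 5 → E) :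
    ∑ i : Fin 5, (-1) ^ (i : ℕ) • fderiv ℝ (fun t => Φ.pullback f t (i.removeNth v)) t₀ (v i) =
      0 := by
  have hh := contDiffAt_extChartAt_comp (hf.contMDiffAt (hU.mem_nhds ht₀))
  have hη := contDiffAt_formInChart Φ (f t₀) (mem_extChartAt_target (I := 𝓡 8) (f t₀))
  have hev := Φ.pullback_eventuallyEq hU hf ht₀
  have hd : DifferentiableAt ℝ (Φ.pullback f) t₀ := by
    refine DifferentiableAt.congr_of_eventuallyEq ?_ hev
    refine DifferentiableAt.continuousAlternatingMapCompContinuousLinearMap ?_ ?_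
    · exact (ContDiffAt.comp (f := fun t => extChartAt (𝓡 8) (f t₀) (f t)) t₀ hη hh
        ).differentiableAt (by simp)
    · exact (hh.fderiv_right (m := ∞) (by simp)).differentiableAt (by simp)
  rw [← extDeriv_apply hd, Filter.EventuallyEq.extDeriv_eq hev]
  have := extDeriv_pullback (f := fun t => extChartAt (𝓡 8) (f t₀) (f t))
    (hη.differentiableAt (by simp)) hh
    (by rw [minSmoothness_of_isRCLikeNormedField]
        exact WithTop.coe_le_coe.2 (le_top : (2 : ℕ∞) ≤ ⊤))
  rw [this, hΦ.extDeriv_formInChart (f t₀) (mem_extChartAt_target _)]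
  rfl

end Pullback

/-- The value of an alternating form on the edge vectors `vⱼ - v₀` of a simplex. It accounts for the
face opposite to the origin in Stokes' theorem. -/
theorem map_sub_const_four {E : Type*} [NormedAddCommGroup E] [NormedSpace ℝ E]
    (f : E [⋀^Fin 4]→L[ℝ] ℝ) (v : Fin 5 → E) :
    f (fun j => v j.succ - v 0) = ∑ i : Fin 5, (-1) ^ (i : ℕ) * f (i.removeNth v) := by
  have z01 : ∀ c d x : E, f ![x, x, c, d] = 0 := fun c d x =>
    f.map_eq_zero_of_eq _ (i := 0) (j := 1) rfl (by decide)
  have z02 : ∀ b d x : E, f ![x, b, x, d] = 0 := fun b d x =>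
    f.map_eq_zero_of_eq _ (i := 0) (j := 2) rfl (by decide)
  have z03 : ∀ b c x : E, f ![x, b, c, x] = 0 := fun b c x =>
    f.map_eq_zero_of_eq _ (i := 0) (j := 3) rfl (by decide)
  have z12 : ∀ a d x : E, f ![a, x, x, d] = 0 := fun a d x =>
    f.map_eq_zero_of_eq _ (i := 1) (j := 2) rfl (by decide)
  have z13 : ∀ a c x : E, f ![a, x, c, x] = 0 := fun a c x =>
    f.map_eq_zero_of_eq _ (i := 1) (j := 3) rfl (by decide)
  have z23 : ∀ a b x : E, f ![a, b, x, x] = 0 := fun a b x =>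
    f.map_eq_zero_of_eq _ (i := 2) (j := 3) rfl (by decide)
  have u0 : ∀ (b c d x y : E), f ![x - y, b, c, d] = f ![x, b, c, d] - f ![y, b, c, d] := by
    intro b c d x y
    have h : ∀ x, ![x, b, c, d] = Function.update ![0, b, c, d] 0 x := by
      intro x; ext1 i; fin_cases i <;> rfl
    rw [h, f.map_update_sub, ← h, ← h]
  have u1 : ∀ (a c d x y : E), f ![a, x - y, c, d] = f ![a, x, c, d] - f ![a, y, c, d] := by
    intro a c d x y
    have h : ∀ x, ![a, x, c, d] = Function.update ![a, 0, c, d] 1 x := by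
      intro x; ext1 i; fin_cases i <;> rfl
    rw [h, f.map_update_sub, ← h, ← h]
  have u2 : ∀ (a b d x y : E), f ![a, b, x - y, d] = f ![a, b, x, d] - f ![a, b, y, d] := by
    intro a b d x y
    have h : ∀ x, ![a, b, x, d] = Function.update ![a, b, 0, d] 2 x := by
      intro x; ext1 i; fin_cases i <;> rfl
    rw [h, f.map_update_sub, ← h, ← h]
  have u3 : ∀ (a b c x y : E), f ![a, b, c, x - y] = f ![a, b, c, x] - f ![a, b, c, y] := by
    intro a b c x y
    have h : ∀ x, ![a, b, c, x] = Function.update ![a, b, c, 0] 3 x := by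
      intro x; ext1 i; fin_cases i <;> rfl
    rw [h, f.map_update_sub, ← h, ← h]
  have s01 : ∀ a b c d : E, f ![a, b, c, d] = - f ![b, a, c, d] := by
    intro a b c d
    refine Eq.trans (congrArg f ?_) (f.toAlternatingMap.map_swap ![b, a, c, d]
      (show (0 : Fin 4) ≠ 1 by decide))
    ext1 i; fin_cases i <;> rfl
  have s12 : ∀ a b c d : E, f ![a, b, c, d] = - f ![a, c, b, d] := by
    intro a b c d
    refine Eq.trans (congrArg f ?_) (f.toAlternatingMap.map_swap ![a, c, b, d]
      (show (1 : Fin 4) ≠ 2 by decide))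
    ext1 i; fin_cases i <;> rfl
  have s23 : ∀ a b c d : E, f ![a, b, c, d] = - f ![a, b, d, c] := by
    intro a b c d
    refine Eq.trans (congrArg f ?_) (f.toAlternatingMap.map_swap ![a, b, d, c]
      (show (2 : Fin 4) ≠ 3 by decide))
    ext1 i; fin_cases i <;> rfl
  have r : ∀ i : Fin 5, f (i.removeNth v) = f ![v (i.succAbove 0), v (i.succAbove 1),
      v (i.succAbove 2), v (i.succAbove 3)] := by
    intro i
    congr 1; ext1 j; fin_cases j <;> rfl
  have l : (fun j : Fin 4 => v j.succ - v 0) = ![v 1 - v 0, v 2 - v 0, v 3 - v 0, v 4 - v 0] := by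
    ext1 j; fin_cases j <;> rfl
  have r0 : f ((0 : Fin 5).removeNth v) = f ![v 1, v 2, v 3, v 4] := r 0
  have r1 : f ((1 : Fin 5).removeNth v) = f ![v 0, v 2, v 3, v 4] := r 1
  have r2 : f ((2 : Fin 5).removeNth v) = f ![v 0, v 1, v 3, v 4] := r 2
  have r3 : f ((3 : Fin 5).removeNth v) = f ![v 0, v 1, v 2, v 4] := r 3
  have r4 : f ((4 : Fin 5).removeNth v) = f ![v 0, v 1, v 2, v 3] := r 4
  rw [l, Fin.sum_univ_five, r0, r1, r2, r3, r4]
  simp only [u0, u1, u2, u3, z01, z02, z03, z12, z13, z23]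
  rw [s01 (v 1) (v 0) (v 3) (v 4), s12 (v 1) (v 2) (v 0) (v 4), s01 (v 1) (v 0) (v 2) (v 4),
    s23 (v 1) (v 2) (v 3) (v 0), s12 (v 1) (v 2) (v 0) (v 3), s01 (v 1) (v 0) (v 2) (v 3)]
  norm_num
  ring

/-! ### Integration over smooth singular chains -/

section Integral

variable {M : Type*} [TopologicalSpace M] [ChartedSpace (EuclideanSpace ℝ (Fin 8)) M]

/-- The value of `σ^* Φ` on the coordinate frame of the standard simplex. -/
noncomputable def SmoothSimplex.density (Φ : Spin7Structure M) (σ : SmoothSimplex M 4)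
    (t : Fin 4 → ℝ) : ℝ :=
  Φ.pullback σ.extend t fun k => Pi.single k 1

/-- The integral of `Φ` over a smooth singular simplex. -/
noncomputable def SmoothSimplex.integral (Φ : Spin7Structure M) (σ : SmoothSimplex M 4) : ℝ :=
  ∫ t in interior (stdCorner 4), σ.density Φ t

/-- The integral of `Φ` over a smooth singular chain. -/
noncomputable def chainIntegral (Φ : Spin7Structure M) : Chain M 4 →+ ℝ :=
  Finsupp.liftAddHom fun σ => (AddMonoidHom.mulRight (σ.integral Φ)).comp (Int.castAddHom ℝ)

theorem chainIntegral_single (Φ : Spin7Structure M) (σ : SmoothSimplex M 4) (m : ℤ) :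
    chainIntegral Φ (Finsupp.single σ m) = m * σ.integral Φ := by
  simp [chainIntegral]

theorem SmoothSimplex.extend_of_mem {n : ℕ} (σ : SmoothSimplex M n) {t : Fin n → ℝ}
    (ht : t ∈ stdCorner n) : σ.extend t = σ.toFun ⟨t, ht⟩ := dif_pos ht

theorem SmoothSimplex.extend_eventuallyEq {n : ℕ} (σ : SmoothSimplex M n) {f : (Fin n → ℝ) → M}
    (hf : ∀ t : stdCorner n, f t = σ.toFun t) {t : Fin n → ℝ} (ht : t ∈ interior (stdCorner n)) :
    σ.extend =ᶠ[𝓝 t] f := by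
  filter_upwards [isOpen_interior.mem_nhds ht] with s hs
  rw [σ.extend_of_mem (interior_subset hs), hf ⟨s, interior_subset hs⟩]

/-- The integral over a simplex may be computed with any extension of it, and over the closed
standard simplex. -/
theorem SmoothSimplex.integral_eq (Φ : Spin7Structure M) (σ : SmoothSimplex M 4)
    {f : (Fin 4 → ℝ) → M} (hf : ∀ t : stdCorner 4, f t = σ.toFun t) :
    σ.integral Φ = ∫ t in stdCorner 4, Φ.pullback f t fun k => Pi.single k 1 := by
  rw [SmoothSimplex.integral, ← setIntegral_congr_set (interior_ae_eq_stdCorner 4)]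
  refine setIntegral_congr_fun isOpen_interior.measurableSet fun t ht => ?_
  rw [SmoothSimplex.density, Φ.pullback_congr (σ.extend_eventuallyEq hf ht)]

theorem fderiv_faceMap_succ {n : ℕ} (i : Fin (n + 1)) (t v : Fin n → ℝ) :
    fderiv ℝ (faceMap i.succ) t v = (i.insertNth (0 : ℝ) v : Fin (n + 1) → ℝ) := by
  have : HasFDerivAt (faceMap i.succ) (ContinuousLinearMap.pi fun j : Fin (n + 1) =>
      (i.insertNth (0 : (Fin n → ℝ) →L[ℝ] ℝ) (fun l => ContinuousLinearMap.proj l) :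
        Fin (n + 1) → (Fin n → ℝ) →L[ℝ] ℝ) j) t := by
    rw [hasFDerivAt_pi]
    intro j
    simp only [faceMap_succ]
    refine Fin.succAboveCases i ?_ (fun l => ?_) j
    · simpa using hasFDerivAt_const (0 : ℝ) t
    · simp only [Fin.insertNth_apply_succAbove]
      exact hasFDerivAt_apply l t
  rw [this.fderiv]
  ext j
  refine Fin.succAboveCases i ?_ (fun l => ?_) j <;> simp

theorem fderiv_faceMap_zero {n : ℕ} (t v : Fin n → ℝ) :
    fderiv ℝ (faceMap 0) t v = (Fin.cons (-∑ i, v i) v : Fin (n + 1) → ℝ) := by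
  have : HasFDerivAt (faceMap 0) (ContinuousLinearMap.pi fun j : Fin (n + 1) =>
      (Fin.cons (-∑ i, ContinuousLinearMap.proj i) (fun l => ContinuousLinearMap.proj l) :
        Fin (n + 1) → (Fin n → ℝ) →L[ℝ] ℝ) j) t := by
    rw [hasFDerivAt_pi]
    intro j
    simp only [faceMap_zero]
    refine Fin.cases ?_ (fun l => ?_) j
    · simp only [Fin.cons_zero]
      exact (HasFDerivAt.fun_sum fun i _ => (ContinuousLinearMap.proj (R := ℝ)
        (φ := fun _ : Fin n => ℝ) i).hasFDerivAt).const_sub 1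
    · simp only [Fin.cons_succ]
      exact hasFDerivAt_apply l t
  rw [this.fderiv]
  ext j
  refine Fin.cases ?_ (fun l => ?_) j <;> simp

theorem fderiv_faceMap_succ_single {n : ℕ} (i : Fin (n + 1)) (t : Fin n → ℝ) (k : Fin n) :
    fderiv ℝ (faceMap i.succ) t (Pi.single k 1) = Pi.single (i.succAbove k) (1 : ℝ) := by
  rw [fderiv_faceMap_succ]
  ext j
  refine Fin.succAboveCases i ?_ (fun l => ?_) j
  · simp
  · simp [Pi.single_apply]

theorem fderiv_faceMap_zero_single {n : ℕ} (t : Fin n → ℝ) (k : Fin n) :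
    fderiv ℝ (faceMap 0) t (Pi.single k 1) =
      (Pi.single k.succ 1 - Pi.single 0 1 : Fin (n + 1) → ℝ) := by
  rw [fderiv_faceMap_zero]
  ext j
  refine Fin.cases ?_ (fun l => ?_) j
  · simp [Pi.single_apply, (Fin.succ_ne_zero k).symm]
  · simp [Pi.single_apply]

variable [IsManifold (𝓡 8) ∞ M]

/-- Stokes' theorem for the closed form `Φ` and a smooth singular simplex. -/
theorem chainIntegral_boundary_single {Φ : Spin7Structure M} (hΦ : Φ.IsTorsionFree)
    (σ : SmoothSimplex M 5) (m : ℤ) :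
    chainIntegral Φ (boundary 4 (Finsupp.single σ m)) = 0 := by
  obtain ⟨U, hU, hΔ, f, hf, hfσ⟩ := σ.smooth'
  set e : Fin 5 → Fin 5 → ℝ := fun i => Pi.single i 1 with he
  -- the vector field whose divergence is the exterior derivative of the pullback
  set F : Fin 5 → (Fin 5 → ℝ) → ℝ := fun i x =>
    (-1) ^ (i : ℕ) * Φ.pullback f x (i.removeNth e) with hF
  have hη : ∀ a, ContDiffOn ℝ 1 (fun x => Φ.pullback f x a) U := fun a x hx =>
    ((Φ.contDiffAt_pullback_apply hU hf hx a).of_le (by simp)).contDiffWithinAt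
  have hFc : ∀ i, ContDiffOn ℝ 1 (F i) U := fun i => contDiffOn_const.mul (hη _)
  have hstokes := setIntegral_divergence_stdCorner F hU hΔ hFc
  have hdiv : ∫ x in stdCorner 5, ∑ i, fderiv ℝ (F i) x (Pi.single i 1) = 0 := by
    rw [setIntegral_congr_fun (g := fun _ => (0 : ℝ)) (isClosed_stdCorner 5).measurableSet,
      integral_zero]
    intro x hx
    have h := hΦ.sum_fderiv_pullback hU hf (hΔ hx) e
    simp only [zsmul_eq_mul] at h ⊢
    rw [← h]
    refine Finset.sum_congr rfl fun i _ => ?_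
    have hd : DifferentiableAt ℝ (fun x => Φ.pullback f x (i.removeNth e)) x :=
      ((hη _).contDiffAt (hU.mem_nhds (hΔ hx))).differentiableAt one_ne_zero
    simp only [hF]
    rw [fderiv_const_mul hd]
    simp [he]
  have hface : ∀ k : Fin 6, (σ.face k).integral Φ = ∫ t in stdCorner 4,
      Φ.pullback f (faceMap k t) fun l => fderiv ℝ (faceMap k) t (Pi.single l 1) := by
    intro k
    rw [SmoothSimplex.integral_eq Φ (σ.face k) (f := f ∘ faceMap k)
      (fun t => hfσ ⟨_, faceMap_mem k t.2⟩)]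
    refine setIntegral_congr_fun (isClosed_stdCorner 4).measurableSet fun t ht => ?_
    have hx := hΔ (faceMap_mem k ht)
    rw [Φ.pullback_comp ((hf.contMDiffAt (hU.mem_nhds hx)).mdifferentiableAt (by simp))
      ((contDiff_faceMap k).contDiffAt.differentiableAt (by simp))]
    rfl
  have hsucc : ∀ i : Fin 5, (σ.face i.succ).integral Φ =
      (-1) ^ (i : ℕ) * ∫ t in stdCorner 4, F i (faceMap i.succ t) := by
    intro i
    rw [hface, ← integral_const_mul]
    refine setIntegral_congr_fun (isClosed_stdCorner 4).measurableSet fun t ht => ?_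
    simp only [hF, fderiv_faceMap_succ_single]
    rw [← mul_assoc, ← mul_pow]
    simp [he]
    rfl
  have hzero : (σ.face 0).integral Φ = ∑ i, ∫ t in stdCorner 4, F i (faceMap 0 t) := by
    rw [hface, ← integral_finsetSum]
    · refine setIntegral_congr_fun (isClosed_stdCorner 4).measurableSet fun t ht => ?_
      simp only [hF, fderiv_faceMap_zero_single]
      exact map_sub_const_four _ e
    · intro i _
      exact (((hFc i).continuousOn.mono hΔ).comp (contDiff_faceMap 0).continuous.continuousOn
        fun a ha => faceMap_mem 0 ha).integrableOn_compact (isCompact_stdCorner _)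
  have hb : chainIntegral Φ (boundary 4 (Finsupp.single σ m)) =
      m * ∑ k : Fin 6, (-1) ^ (k : ℕ) * (σ.face k).integral Φ := by
    simp only [boundary, Finsupp.liftAddHom_apply_single, AddMonoidHom.finsetSum_apply, map_sum,
      AddMonoidHom.smul_apply, map_zsmul, Finsupp.singleAddHom_apply, chainIntegral_single,
      zsmul_eq_mul, Finset.mul_sum]
    refine Finset.sum_congr rfl fun k _ => ?_
    push_cast
    ring
  rw [hb, Fin.sum_univ_succ, hzero]
  rw [hdiv, Finset.sum_sub_distrib] at hstokes
  have : ∑ i : Fin 5, (-1 : ℝ) ^ ((i.succ : Fin 6) : ℕ) * (σ.face i.succ).integral Φ =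
      - ∑ i, ∫ t in stdCorner 4, F i (faceMap i.succ t) := by
    rw [← Finset.sum_neg_distrib]
    refine Finset.sum_congr rfl fun i _ => ?_
    rw [hsucc, Fin.val_succ, pow_succ, ← mul_assoc,
      show (-1 : ℝ) ^ (i : ℕ) * -1 * (-1) ^ (i : ℕ) = -((-1) * (-1)) ^ (i : ℕ) by
        rw [mul_pow]; ring]
    simp
  rw [this]
  simp only [Fin.val_zero, pow_zero, one_mul]
  rw [← sub_eq_add_neg, ← hstokes, mul_zero]

/-- Closed forms integrate to zero over boundaries. -/
theorem chainIntegral_boundary {Φ : Spin7Structure M} (hΦ : Φ.IsTorsionFree)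
    (c : Chain M 5) : chainIntegral Φ (boundary 4 c) = 0 := by
  induction c using Finsupp.induction_linear with
  | zero => simp
  | add c d hc hd => rw [map_add, map_add, hc, hd, add_zero]
  | single σ m => exact chainIntegral_boundary_single hΦ σ m

end Integral

/-! ### Lifts through embeddings and relative homology -/

section Lift

variable {E H E' H' E'' H'' : Type*} [NormedAddCommGroup E] [NormedSpace ℝ E]
  [TopologicalSpace H] {I : ModelWithCorners ℝ E H} [NormedAddCommGroup E'] [NormedSpace ℝ E']
  [TopologicalSpace H'] {J : ModelWithCorners ℝ E' H'} [NormedAddCommGroup E'']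
  [NormedSpace ℝ E''] [TopologicalSpace H''] {K : ModelWithCorners ℝ E'' H''}
  {N X M : Type*} [TopologicalSpace N] [ChartedSpace H N] [TopologicalSpace X] [ChartedSpace H' X]
  [TopologicalSpace M] [ChartedSpace H'' M]

/-- In the charts in which an immersion is `u ↦ (u, 0)`, the first component recovers the point. -/
theorem fst_equiv_symm_codChart {ι : X → M} {y₀ : X} (him : Manifold.IsImmersionAt J K ∞ ι y₀)
    (y : X) {z : M}
    (hy : y ∈ him.domChart.source) (hz : ι y = z) :
    (him.equiv.symm (him.codChart.extend K z)).1 = him.domChart.extend J y := by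
  have h := him.writtenInCharts ((him.domChart.extend J).map_source
    (by rwa [him.domChart.extend_source]))
  simp only [Function.comp_apply] at h
  rw [(him.domChart.extend J).left_inv (by rwa [him.domChart.extend_source]), hz] at h
  rw [h]
  simp

/-- A set-theoretic lift of a smooth map through a smooth embedding is smooth. In the charts in
which the embedding is `u ↦ (u, 0)`, the lift is the first component of the map. -/
theorem contMDiffWithinAt_lift {ι : X → M} (hι : Manifold.IsSmoothEmbedding J K ∞ ι)
    {f : N → M} {l : N → X} {s : Set N} {t : N} (ht : t ∈ s)
    (hf : ContMDiffWithinAt I K ∞ f s t) (hl : ∀ x ∈ s, ι (l x) = f x) :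
    ContMDiffWithinAt I J ∞ l s t := by
  have him := hι.isImmersion.isImmersionAt (l t)
  have hcont : ContinuousWithinAt l s t := by
    rw [hι.isEmbedding.isInducing.continuousWithinAt_iff]
    exact hf.continuousWithinAt.congr hl (hl t ht)
  have hcod : f t ∈ him.codChart.source := hl t ht ▸ him.mem_codChart_source
  rw [contMDiffWithinAt_iff_target_of_mem_maximalAtlas him.domChart_mem_maximalAtlas
    him.mem_domChart_source]
  refine ⟨hcont, ?_⟩
  have h1 : ContMDiffWithinAt I 𝓘(ℝ, E'') ∞ (him.codChart.extend K ∘ f) s t :=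
    ((contMDiffWithinAt_iff_target_of_mem_maximalAtlas him.codChart_mem_maximalAtlas hcod).1 hf).2
  have h2 : ContMDiff 𝓘(ℝ, E'') 𝓘(ℝ, E') ∞ fun u => (him.equiv.symm u).1 :=
    ContDiff.contMDiff (by fun_prop)
  refine ((h2.contMDiffAt (x := him.codChart.extend K (f t))).comp_contMDiffWithinAt t
    h1).congr_of_eventuallyEq ?_ ?_
  · filter_upwards [self_mem_nhdsWithin,
      hcont (him.domChart.open_source.mem_nhds him.mem_domChart_source)] with x hx hxs
    exact (fst_equiv_symm_codChart him _ hxs (hl x hx)).symm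
  · exact (fst_equiv_symm_codChart him _ him.mem_domChart_source (hl t ht)).symm

section Simplex

variable {M : Type*} [TopologicalSpace M] [ChartedSpace (EuclideanSpace ℝ (Fin 8)) M]

theorem SmoothSimplex.contMDiffOn_extend {n : ℕ} (σ : SmoothSimplex M n) :
    ContMDiffOn 𝓘(ℝ, Fin n → ℝ) (𝓡 8) ∞ σ.extend (stdCorner n) := by
  obtain ⟨U, -, hΔ, f, hf, hfσ⟩ := σ.smooth'
  exact (hf.mono hΔ).congr fun t ht => by rw [σ.extend_of_mem ht, hfσ ⟨t, ht⟩]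

theorem SmoothSimplex.contMDiffOn_lift {n : ℕ} (σ : SmoothSimplex M n) {X H : Type*}
    [TopologicalSpace H] {J : ModelWithCorners ℝ E' H} [TopologicalSpace X] [ChartedSpace H X]
    {ι : X → M} (hι : Manifold.IsSmoothEmbedding J (𝓡 8) ∞ ι) {l : (Fin n → ℝ) → X}
    (hl : ∀ t ∈ stdCorner n, ι (l t) = σ.extend t) :
    ContMDiffOn 𝓘(ℝ, Fin n → ℝ) J ∞ l (stdCorner n) :=
  fun t ht => contMDiffWithinAt_lift hι ht (σ.contMDiffOn_extend t ht) hl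

theorem SmoothSimplex.exists_lift {n : ℕ} (σ : SmoothSimplex M n) {X : Type*} {ι : X → M}
    (h : range σ.toFun ⊆ range ι) :
    ∃ l : (Fin n → ℝ) → X, ∀ t ∈ stdCorner n, ι (l t) = σ.extend t := by
  have : ∀ t, ∃ y, ι y = σ.extend t := fun t => by
    unfold SmoothSimplex.extend
    split_ifs with ht
    · exact h (mem_range_self _)
    · exact h (mem_range_self _)
  choose l hl using this
  exact ⟨l, fun t _ => hl t⟩

/-- Simplices in a submanifold on which `Φ` vanishes have integral zero. -/
theorem SmoothSimplex.integral_eq_zero (Φ : Spin7Structure M) {W : Type*} [TopologicalSpace W]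
    [ChartedSpace (EuclideanSpace ℝ (Fin 4)) W] {j : W → M}
    (hj : Manifold.IsSmoothEmbedding (𝓡 4) (𝓡 8) ∞ j)
    (hW : ∀ (w : W) (v : Fin 4 → TangentSpace (𝓡 4) w),
      Φ.form (j w) (fun k => mfderiv (𝓡 4) (𝓡 8) j w (v k)) = 0)
    {σ : SmoothSimplex M 4} (hσ : range σ.toFun ⊆ range j) : σ.integral Φ = 0 := by
  obtain ⟨l, hl⟩ := σ.exists_lift hσ
  refine setIntegral_eq_zero_of_forall_eq_zero fun t ht => ?_
  have hlt : MDifferentiableAt 𝓘(ℝ, Fin 4 → ℝ) (𝓡 4) l t :=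
    ((σ.contMDiffOn_lift hj hl).contMDiffAt (mem_interior_iff_mem_nhds.1 ht)
      ).mdifferentiableAt (by simp)
  have hjt : MDifferentiableAt (𝓡 4) (𝓡 8) j (l t) :=
    (hj.contMDiff (l t)).mdifferentiableAt (by simp)
  have heq : σ.extend =ᶠ[𝓝 t] j ∘ l := by
    filter_upwards [mem_interior_iff_mem_nhds.1 ht] with s hs using (hl s hs).symm
  rw [SmoothSimplex.density, Φ.pullback_congr heq]
  refine Eq.trans (congrArg (Φ.form (j (l t))) (funext fun k => ?_))
    (hW (l t) fun k => mfderiv 𝓘(ℝ, Fin 4 → ℝ) (𝓡 4) l t (Pi.single k (1 : ℝ) : Fin 4 → ℝ))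
  exact DFunLike.congr_fun (mfderiv_comp t hjt hlt) _

variable [IsManifold (𝓡 8) ∞ M]

/-- The integral of `Φ` depends only on the relative homology class if `Φ` vanishes on the
submanifold. -/
theorem chainIntegral_eq_of_relClass_eq {Φ : Spin7Structure M} (hΦ : Φ.IsTorsionFree) {W : Type*}
    [TopologicalSpace W] [ChartedSpace (EuclideanSpace ℝ (Fin 4)) W] {j : W → M}
    (hj : Manifold.IsSmoothEmbedding (𝓡 4) (𝓡 8) ∞ j)
    (hW : ∀ (w : W) (v : Fin 4 → TangentSpace (𝓡 4) w),
      Φ.form (j w) (fun k => mfderiv (𝓡 4) (𝓡 8) j w (v k)) = 0)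
    {c c' : relCycles (range j) 3} (h : relClass (range j) 3 c = relClass (range j) 3 c') :
    chainIntegral Φ c = chainIntegral Φ c' := by
  have hmem := AddSubgroup.mem_addSubgroupOf.1 (QuotientAddGroup.eq.1 h)
  obtain ⟨b, ⟨S, rfl⟩, z, hz, hbz⟩ := AddSubgroup.mem_sup.1 hmem
  have hz0 : chainIntegral Φ z = 0 := by
    rw [chainIntegral, Finsupp.liftAddHom_apply, Finsupp.sum]
    refine Finset.sum_eq_zero fun σ hσ => ?_
    simp [SmoothSimplex.integral_eq_zero Φ hj hW (hz σ hσ)]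
  have := congrArg (chainIntegral Φ) hbz
  rw [map_add, chainIntegral_boundary hΦ, hz0] at this
  simp only [AddSubgroup.coe_add, NegMemClass.coe_neg, map_add, map_neg] at this
  linarith

end Simplex

end Lift

/-! ### Volumes of parallelepipeds and Jacobians -/

section Gram

variable {M : Type*} [TopologicalSpace M] [ChartedSpace (EuclideanSpace ℝ (Fin 8)) M]
  (Φ : Spin7Structure M)

theorem Spin7Structure.gramVolume_nonneg (x : M) (v : Fin 4 → TangentSpace (𝓡 8) x) :
    0 ≤ Φ.gramVolume x v := Real.sqrt_nonneg _

theorem Spin7Structure.gramVolume_sum_smul (x : M) (B : Matrix (Fin 4) (Fin 4) ℝ)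
    (w : Fin 4 → TangentSpace (𝓡 8) x) :
    Φ.gramVolume x (fun k => ∑ j, B k j • w j) = |B.det| * Φ.gramVolume x w := by
  have h : (Matrix.of fun i j => Φ.metric x (∑ a, B i a • w a) (∑ b, B j b • w b)) =
      B * (Matrix.of fun i j => Φ.metric x (w i) (w j)) * B.transpose := by
    ext i j
    simp only [Spin7Structure.metric, map_sum, map_smul, sum_inner, inner_sum, real_inner_smul_left,
      real_inner_smul_right, Matrix.of_apply, Matrix.mul_apply, Matrix.transpose_apply,
      Finset.sum_mul]
    exact Finset.sum_congr rfl fun _ _ => Finset.sum_congr rfl fun _ _ => by ring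
  rw [Spin7Structure.gramVolume, h, Matrix.det_mul, Matrix.det_mul, Matrix.det_transpose,
    show B.det * (Matrix.of fun i j => Φ.metric x (w i) (w j)).det * B.det =
      B.det ^ 2 * (Matrix.of fun i j => Φ.metric x (w i) (w j)).det by ring,
    Real.sqrt_mul (sq_nonneg _), Real.sqrt_sq_eq_abs]
  rfl

variable {V : Type*} [AddCommGroup V] [Module ℝ V]

theorem Spin7Structure.gramVolume_basis (x : M) (A : V →ₗ[ℝ] TangentSpace (𝓡 8) x)
    (b₀ b : Basis (Fin 4) ℝ V) :
    Φ.gramVolume x (fun k => A (b k)) = |b₀.det b| * Φ.gramVolume x fun k => A (b₀ k) := by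
  rw [Basis.det_apply, ← Matrix.det_transpose, ← Φ.gramVolume_sum_smul]
  congr 1
  ext1 k
  refine (congrArg A (b₀.sum_repr (b k)).symm).trans ?_
  simp only [map_sum, map_smul, Matrix.transpose_apply, Basis.toMatrix_apply]

theorem Spin7Structure.form_basis (x : M) (A : V →ₗ[ℝ] TangentSpace (𝓡 8) x)
    (b₀ b : Basis (Fin 4) ℝ V) :
    Φ.form x (fun k => A (b k)) = b₀.det b * Φ.form x fun k => A (b₀ k) := by
  have := DFunLike.congr_fun (((Φ.form x).toAlternatingMap.compLinearMap A
    ).eq_smul_basis_det b₀) (⇑b)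
  rw [AlternatingMap.smul_apply, smul_eq_mul, mul_comm] at this
  exact this

/-- The Cayley condition for the image of a positively oriented basis `b` is equivalent to that for
the image of any other basis `b₀`, with the sign `ε` of `b₀`: a change of basis multiplies the two
sides by a determinant and by its absolute value. -/
theorem Spin7Structure.form_eq_gramVolume_of_basis (x : M) (A : V →ₗ[ℝ] TangentSpace (𝓡 8) x)
    {b₀ b : Basis (Fin 4) ℝ V} {o : Orientation ℝ V (Fin 4)} (hb : b.orientation = o) (ε : ℤˣ)
    (hb₀ : b₀.orientation = if ε = 1 then o else -o) :
    Φ.form x (fun k => A (b k)) = Φ.gramVolume x (fun k => A (b k)) ↔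
      ((ε : ℤ) : ℝ) * Φ.form x (fun k => A (b₀ k)) = Φ.gramVolume x fun k => A (b₀ k) := by
  rw [Φ.gramVolume_basis x A b₀ b, Φ.form_basis x A b₀ b]
  rcases Int.units_eq_one_or ε with rfl | rfl
  · rw [if_pos rfl, ← hb] at hb₀
    have h := (Basis.orientation_eq_iff_det_pos _ _).1 hb₀
    rw [abs_of_pos h]
    simp [h.ne']
  · rw [if_neg (by decide), ← hb] at hb₀
    have h : b₀.det b < 0 := by
      rcases lt_trichotomy (b₀.det b) 0 with h | h | h
      · exact h
      · exact absurd h (b₀.isUnit_det b).ne_zero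
      · have := (Basis.orientation_eq_iff_det_pos _ _).2 h
        rw [hb₀] at this
        exact absurd this.symm (Module.Ray.ne_neg_self _)
    rw [abs_of_neg h]
    simp only [Units.val_neg, Units.val_one, Int.cast_neg, Int.cast_one]
    rw [neg_mul_comm, mul_right_inj' h.ne, neg_one_mul, neg_eq_iff_eq_neg]

end Gram

section VolumeDensity

variable {M : Type*} [TopologicalSpace M] [ChartedSpace (EuclideanSpace ℝ (Fin 8)) M]

/-- The volume of the parallelepiped spanned by the partial derivatives of a map `ℝ⁴ → M`. -/
noncomputable def Spin7Structure.jacobian (Φ : Spin7Structure M) (f : (Fin 4 → ℝ) → M)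
    (t : Fin 4 → ℝ) : ℝ :=
  Φ.gramVolume (f t) fun k => mfderiv 𝓘(ℝ, Fin 4 → ℝ) (𝓡 8) f t (Pi.single k (1 : ℝ) : Fin 4 → ℝ)

theorem Spin7Structure.gramVolume_congr (Φ : Spin7Structure M) {x y : M} (h : x = y)
    {v : Fin 4 → TangentSpace (𝓡 8) x} {w : Fin 4 → TangentSpace (𝓡 8) y}
    (hvw : ∀ k, (v k : EuclideanSpace ℝ (Fin 8)) = w k) :
    Φ.gramVolume x v = Φ.gramVolume y w := by
  subst h
  exact congrArg (Φ.gramVolume x) (funext hvw)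

theorem Spin7Structure.form_congr (Φ : Spin7Structure M) {x y : M} (h : x = y)
    {v : Fin 4 → TangentSpace (𝓡 8) x} {w : Fin 4 → TangentSpace (𝓡 8) y}
    (hvw : ∀ k, (v k : EuclideanSpace ℝ (Fin 8)) = w k) :
    Φ.form x v = Φ.form y w := by
  subst h
  exact congrArg (Φ.form x) (funext hvw)

theorem Spin7Structure.jacobian_congr (Φ : Spin7Structure M) {f g : (Fin 4 → ℝ) → M}
    {t : Fin 4 → ℝ} (h : f =ᶠ[𝓝 t] g) : Φ.jacobian f t = Φ.jacobian g t :=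
  Φ.gramVolume_congr h.eq_of_nhds fun k =>
    DFunLike.congr_fun (h.mfderiv_eq (I := 𝓘(ℝ, Fin 4 → ℝ)) (I' := 𝓡 8)) (Pi.single k (1 : ℝ))

variable [IsManifold (𝓡 8) ∞ M]

theorem Spin7Structure.continuousOn_jacobian (Φ : Spin7Structure M) {f : (Fin 4 → ℝ) → M}
    {U : Set (Fin 4 → ℝ)} (hU : IsOpen U) (hf : ContMDiffOn 𝓘(ℝ, Fin 4 → ℝ) (𝓡 8) ∞ f U) :
    ContinuousOn (Φ.jacobian f) U := by
  have : IsManifold (𝓡 8) 1 M := IsManifold.of_le (n := ∞) (by simp)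
  intro t ht
  refine Φ.continuousWithinAt_gramVolume fun k => ?_
  have h := hf.continuousOn_tangentMapWithin (by simp) hU.uniqueMDiffOn
  have hc : Continuous fun s : Fin 4 → ℝ => (⟨s, (Pi.single k (1 : ℝ) : Fin 4 → ℝ)⟩ :
      TangentBundle 𝓘(ℝ, Fin 4 → ℝ) (Fin 4 → ℝ)) := by
    exact (tangentBundleModelSpaceHomeomorph 𝓘(ℝ, Fin 4 → ℝ)).symm.continuous.comp
      (continuous_id.prodMk continuous_const)
  refine ((h.comp hc.continuousOn fun s hs => hs) t ht).congr (fun s hs => ?_) ?_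
  · simp only [Function.comp_apply, tangentMapWithin, mfderivWithin_of_isOpen hU hs]
  · simp only [Function.comp_apply, tangentMapWithin, mfderivWithin_of_isOpen hU ht]

end VolumeDensity

/-! ### The Riemannian measure of a submanifold cut into simplices -/

section ChartVolume

variable {M : Type*} [TopologicalSpace M] [ChartedSpace (EuclideanSpace ℝ (Fin 8)) M]
  {X : Type*} [TopologicalSpace X] [ChartedSpace (EuclideanHalfSpace 4) X] {ι : X → M}

theorem measurableSet_extChartAt_target (y₀ : X) :
    MeasurableSet (extChartAt (𝓡∂ 4) y₀).target := by
  rw [extChartAt_target]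
  exact ((chartAt _ y₀).open_target.preimage (𝓡∂ 4).continuous_symm).measurableSet.inter
    (𝓡∂ 4).isClosed_range.measurableSet

/-- The measure on `X` given in the chart around `y₀`; `volumeMeasure` is the supremum of these. -/
noncomputable def chartVolume [MeasurableSpace X] (Φ : Spin7Structure M)
    (ι : X → M) (y₀ : X) : Measure X :=
  ((volume.restrict (extChartAt (𝓡∂ 4) y₀).target).withDensity
    fun u => ENNReal.ofReal (volumeDensity Φ ι y₀ u)).map (extChartAt (𝓡∂ 4) y₀).symm

theorem chartVolume_apply [MeasurableSpace X] [BorelSpace X] (Φ : Spin7Structure M) (y₀ : X)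
    {A : Set X} (hA : MeasurableSet A) :
    chartVolume Φ ι y₀ A = ∫⁻ u in extChartAt (𝓡∂ 4) y₀ '' (A ∩ (extChartAt (𝓡∂ 4) y₀).source),
      ENNReal.ofReal (volumeDensity Φ ι y₀ u) := by
  have hm : AEMeasurable (extChartAt (𝓡∂ 4) y₀).symm
      ((volume.restrict (extChartAt (𝓡∂ 4) y₀).target).withDensity
        fun u => ENNReal.ofReal (volumeDensity Φ ι y₀ u)) :=
    ((continuousOn_extChartAt_symm y₀).aemeasurable (measurableSet_extChartAt_target y₀)).mono_ac
      (withDensity_absolutelyContinuous _ _)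
  rw [chartVolume, Measure.map_apply_of_aemeasurable hm hA, withDensity_apply',
    Measure.restrict_restrict' (measurableSet_extChartAt_target y₀)]
  congr 2
  rw [inter_comm, inter_comm A, PartialEquiv.image_source_inter_eq']

variable [IsManifold (𝓡∂ 4) ∞ X]

/-- A map to `X`, read in the chart around `y₀` as a map between coordinate spaces. -/
noncomputable def coordMap (y₀ : X) (l : (Fin 4 → ℝ) → X) (t : Fin 4 → ℝ) : Fin 4 → ℝ :=
  WithLp.ofLp (extChartAt (𝓡∂ 4) y₀ (l t))

theorem contMDiffOn_extChartAt_comp {s : Set (Fin 4 → ℝ)} {l : (Fin 4 → ℝ) → X}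
    (hl : ContMDiffOn 𝓘(ℝ, Fin 4 → ℝ) (𝓡∂ 4) ∞ l s) (y₀ : X) :
    ContDiffOn ℝ ∞ (extChartAt (𝓡∂ 4) y₀ ∘ l) (s ∩ l ⁻¹' (extChartAt (𝓡∂ 4) y₀).source) := by
  rw [← contMDiffOn_iff_contDiffOn]
  refine ContMDiffOn.comp (t := (chartAt _ y₀).source) contMDiffOn_extChartAt
    (hl.mono inter_subset_left) fun t ht => ?_
  simpa using ht.2

theorem differentiableOn_coordMap {s : Set (Fin 4 → ℝ)} {l : (Fin 4 → ℝ) → X}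
    (hl : ContMDiffOn 𝓘(ℝ, Fin 4 → ℝ) (𝓡∂ 4) ∞ l s) (y₀ : X) :
    DifferentiableOn ℝ (coordMap y₀ l) (s ∩ l ⁻¹' (extChartAt (𝓡∂ 4) y₀).source) :=
  (PiLp.continuousLinearEquiv 2 ℝ fun _ : Fin 4 => ℝ).differentiable.comp_differentiableOn
    ((contMDiffOn_extChartAt_comp hl y₀).differentiableOn (by simp))

/-- The chain rule for `σ = (ι ∘ chart⁻¹) ∘ (chart ∘ l)`: the volume densities of `σ` and of `X` in
a chart differ by the Jacobian determinant of `l` in this chart. -/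
theorem jacobian_eq_det_mul_volumeDensity (Φ : Spin7Structure M)
    (hι : ContMDiff (𝓡∂ 4) (𝓡 8) ∞ ι) {f : (Fin 4 → ℝ) → M} {l : (Fin 4 → ℝ) → X}
    {U : Set (Fin 4 → ℝ)} (hU : IsOpen U) (hl : ContMDiffOn 𝓘(ℝ, Fin 4 → ℝ) (𝓡∂ 4) ∞ l U)
    (hfl : ∀ t ∈ U, ι (l t) = f t) {y₀ : X} {t : Fin 4 → ℝ} (ht : t ∈ U)
    (hy : l t ∈ (extChartAt (𝓡∂ 4) y₀).source) :
    Φ.jacobian f t = |(fderiv ℝ (coordMap y₀ l) t).det| *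
      volumeDensity Φ ι y₀ (extChartAt (𝓡∂ 4) y₀ (l t)) := by
  set φ := extChartAt (𝓡∂ 4) y₀ with hφ
  set V := U ∩ l ⁻¹' φ.source with hV
  have hVo : IsOpen V := hl.continuousOn.isOpen_inter_preimage hU (isOpen_extChartAt_source y₀)
  have hVt : V ∈ 𝓝 t := hVo.mem_nhds ⟨ht, hy⟩
  have hG : DifferentiableAt ℝ (φ ∘ l) t :=
    ((contMDiffOn_extChartAt_comp hl y₀).contDiffAt hVt).differentiableAt (by simp)
  have hF : MDifferentiableWithinAt 𝓘(ℝ, EuclideanSpace ℝ (Fin 4)) (𝓡 8) (ι ∘ φ.symm)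
      (range (𝓡∂ 4)) (φ (l t)) :=
    (hι.mdifferentiable (by simp)).mdifferentiableAt.comp_mdifferentiableWithinAt _
      (mdifferentiableWithinAt_extChartAt_symm (φ.map_source hy))
  have hsub : V ⊆ (φ ∘ l) ⁻¹' range (𝓡∂ 4) := fun s hs =>
    extChartAt_target_subset_range y₀ (φ.map_source hs.2)
  have hcomp := (HasMFDerivWithinAt.comp t hF.hasMFDerivWithinAt
    hG.hasFDerivAt.hasMFDerivAt.hasMFDerivWithinAt hsub).hasMFDerivAt hVt
  have heq : f =ᶠ[𝓝 t] (ι ∘ φ.symm) ∘ (φ ∘ l) := by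
    filter_upwards [hVt] with s hs
    simp only [Function.comp_apply]
    rw [φ.left_inv hs.2, hfl s hs.1]
  have hder : fderiv ℝ (coordMap y₀ l) t = ((PiLp.continuousLinearEquiv 2 ℝ fun _ : Fin 4 => ℝ) :
      EuclideanSpace ℝ (Fin 4) →L[ℝ] Fin 4 → ℝ) ∘L fderiv ℝ (φ ∘ l) t :=
    (((PiLp.continuousLinearEquiv 2 ℝ fun _ : Fin 4 => ℝ).hasFDerivAt).comp t
      hG.hasFDerivAt).fderiv
  have hdet : (fderiv ℝ (coordMap y₀ l) t).det =
      (Matrix.of fun k j => fderiv ℝ (φ ∘ l) t (Pi.single k 1) j).det := by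
    rw [ContinuousLinearMap.det, ← LinearMap.det_toMatrix', ← Matrix.det_transpose, hder]
    congr 1
  rw [Φ.jacobian_congr heq, hdet, volumeDensity, ← Φ.gramVolume_sum_smul]
  refine Φ.gramVolume_congr rfl fun k => ?_
  refine (DFunLike.congr_fun hcomp.mfderiv (Pi.single k (1 : ℝ) : Fin 4 → ℝ)).trans ?_
  have hsum : ∀ w : EuclideanSpace ℝ (Fin 4), w = ∑ j, w j • EuclideanSpace.single j (1 : ℝ) := by
    intro w
    ext i
    simp [Finset.sum_apply, Pi.single_apply]
  have hlin : ∀ (L : EuclideanSpace ℝ (Fin 4) →L[ℝ] EuclideanSpace ℝ (Fin 8))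
      (w : EuclideanSpace ℝ (Fin 4)), L w = ∑ j, w j • L (EuclideanSpace.single j 1) := by
    intro L w
    conv_lhs => rw [hsum w]
    simp only [map_sum, map_smul]
  exact hlin (mfderivWithin 𝓘(ℝ, EuclideanSpace ℝ (Fin 4)) (𝓡 8) (ι ∘ φ.symm) (range (𝓡∂ 4))
    (φ (l t))) (fderiv ℝ (φ ∘ l) t (Pi.single k 1))

/-- Boundary points of the standard simplex have images of measure zero in charts. -/
theorem volume_coordMap_image_eq_zero {l : (Fin 4 → ℝ) → X}
    (hl : ContMDiffOn 𝓘(ℝ, Fin 4 → ℝ) (𝓡∂ 4) ∞ l (stdCorner 4)) (y₀ : X) :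
    volume (coordMap y₀ l '' ((stdCorner 4 \ interior (stdCorner 4)) ∩
      l ⁻¹' (extChartAt (𝓡∂ 4) y₀).source)) = 0 := by
  refine addHaar_image_eq_zero_of_differentiableOn_of_addHaar_eq_zero _
    ((differentiableOn_coordMap hl y₀).mono (inter_subset_inter_left _ sdiff_subset))
    (measure_mono_null inter_subset_left (volume_stdCorner_diff_interior 4))

/-- In a chart, the measure of a set is the sum of the integrals of the volume densities of the
simplices that cover the manifold without overlap. -/
theorem chartVolume_apply_eq_sum [MeasurableSpace X] [BorelSpace X] (Φ : Spin7Structure M)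
    (hι : ContMDiff (𝓡∂ 4) (𝓡 8) ∞ ι) {N : ℕ} {f : Fin N → (Fin 4 → ℝ) → M}
    {l : Fin N → (Fin 4 → ℝ) → X}
    (hl : ∀ i, ContMDiffOn 𝓘(ℝ, Fin 4 → ℝ) (𝓡∂ 4) ∞ (l i) (stdCorner 4))
    (hlm : ∀ i, Measurable (l i))
    (hfl : ∀ i, ∀ t ∈ stdCorner 4, ι (l i t) = f i t)
    (hcov : ⋃ i, l i '' stdCorner 4 = univ)
    (hinj : ∀ i, InjOn (l i) (interior (stdCorner 4)))
    (hdisj : ∀ i j, i ≠ j → Disjoint (l i '' interior (stdCorner 4))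
      (l j '' interior (stdCorner 4)))
    (y₀ : X) {A : Set X} (hA : MeasurableSet A) (hAs : A ⊆ (extChartAt (𝓡∂ 4) y₀).source) :
    chartVolume Φ ι y₀ A =
      ∑ i, ∫⁻ t in interior (stdCorner 4) ∩ l i ⁻¹' A, ENNReal.ofReal (Φ.jacobian (f i) t) := by
  set φ := extChartAt (𝓡∂ 4) y₀ with hφ
  set S : Fin N → Set (Fin 4 → ℝ) := fun i => interior (stdCorner 4) ∩ l i ⁻¹' A with hS
  have hSm : ∀ i, MeasurableSet (S i) := fun i =>
    isOpen_interior.measurableSet.inter (hlm i hA)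
  have hof : MeasurableEmbedding (WithLp.ofLp : EuclideanSpace ℝ (Fin 4) → Fin 4 → ℝ) :=
    (MeasurableEquiv.toLp 2 (Fin 4 → ℝ)).symm.measurableEmbedding
  have hopen : ∀ i, IsOpen (interior (stdCorner 4) ∩ l i ⁻¹' φ.source) := fun i =>
    ((hl i).mono interior_subset).continuousOn.isOpen_inter_preimage isOpen_interior
      (isOpen_extChartAt_source y₀)
  have hd : ∀ i, ∀ t ∈ S i, HasFDerivWithinAt (coordMap y₀ (l i))
      (fderiv ℝ (coordMap y₀ (l i)) t) (S i) t := by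
    intro i t ht
    have hmem : interior (stdCorner 4) ∩ l i ⁻¹' φ.source ∈ 𝓝 t :=
      (hopen i).mem_nhds ⟨ht.1, hAs ht.2⟩
    exact ((differentiableOn_coordMap ((hl i).mono interior_subset) y₀).differentiableAt
      hmem).hasFDerivAt.hasFDerivWithinAt
  have hφinj : InjOn (fun y => WithLp.ofLp (φ y)) φ.source := fun a ha b hb hab =>
    φ.injOn ha hb (WithLp.ofLp_injective 2 hab)
  have hcinj : ∀ i, InjOn (coordMap y₀ (l i)) (S i) := fun i s hs t ht hst =>
    hinj i hs.1 ht.1 (hφinj (hAs hs.2) (hAs ht.2) hst)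
  have hdisj' : Pairwise (Function.onFun Disjoint fun i => coordMap y₀ (l i) '' S i) := by
    intro i j hij
    rw [Function.onFun, Set.disjoint_left]
    rintro _ ⟨s, hs, rfl⟩ ⟨t, ht, hst⟩
    have := hφinj (hAs ht.2) (hAs hs.2) hst
    exact Set.disjoint_left.1 (hdisj i j hij) ⟨s, hs.1, rfl⟩ ⟨t, ht.1, this⟩
  have hset : (WithLp.ofLp '' (φ '' A) : Set (Fin 4 → ℝ)) =ᵐ[volume]
      ⋃ i, coordMap y₀ (l i) '' S i := by
    have hsub : ⋃ i, coordMap y₀ (l i) '' S i ⊆ WithLp.ofLp '' (φ '' A) := by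
      refine iUnion_subset fun i => ?_
      rintro _ ⟨t, ht, rfl⟩
      exact ⟨_, ⟨l i t, ht.2, rfl⟩, rfl⟩
    refine ae_eq_set.2 ⟨measure_mono_null ?_ (measure_iUnion_null fun i =>
      volume_coordMap_image_eq_zero (hl i) y₀), by rw [sdiff_eq_empty.2 hsub, measure_empty]⟩
    rintro _ ⟨⟨_, ⟨y, hy, rfl⟩, rfl⟩, hn⟩
    obtain ⟨i, t, ht, rfl⟩ := mem_iUnion.1 (hcov.symm ▸ mem_univ y : y ∈ ⋃ i, l i '' stdCorner 4)
    refine mem_iUnion.2 ⟨i, t, ⟨⟨ht, fun hti => hn (mem_iUnion.2 ⟨i, t, ⟨hti, hy⟩, rfl⟩)⟩,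
      hAs hy⟩, rfl⟩
  have hchange : ∫⁻ u in φ '' A, ENNReal.ofReal (volumeDensity Φ ι y₀ u) =
      ∫⁻ w in WithLp.ofLp '' (φ '' A),
        ENNReal.ofReal (volumeDensity Φ ι y₀ (WithLp.toLp 2 w)) :=
    (PiLp.volume_preserving_ofLp (Fin 4)).setLIntegral_comp_emb hof
      (fun u => ENNReal.ofReal (volumeDensity Φ ι y₀ (WithLp.toLp 2 u))) _
  rw [chartVolume_apply Φ y₀ hA, inter_eq_left.2 hAs, hchange, setLIntegral_congr hset,
    lintegral_iUnion (fun i => measurable_image_of_fderivWithin (hSm i) (hd i) (hcinj i)) hdisj',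
    tsum_fintype]
  refine Finset.sum_congr rfl fun i _ => ?_
  rw [lintegral_image_eq_lintegral_abs_det_fderiv_mul volume (hSm i) (hd i) (hcinj i)]
  refine setLIntegral_congr_fun (hSm i) fun t ht => ?_
  rw [← ENNReal.ofReal_mul (abs_nonneg _), jacobian_eq_det_mul_volumeDensity Φ hι isOpen_interior
    ((hl i).mono interior_subset) (fun t ht => hfl i t (interior_subset ht)) ht.1 (hAs ht.2)]
  rfl

/-- The total volume of a compact submanifold cut into simplices is the sum of the volumes of these
simplices. -/
theorem volumeMeasure_univ_eq_sum [SecondCountableTopology X] [MeasurableSpace X] [BorelSpace X]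
    (Φ : Spin7Structure M)
    (hι : ContMDiff (𝓡∂ 4) (𝓡 8) ∞ ι) {N : ℕ} {f : Fin N → (Fin 4 → ℝ) → M}
    {l : Fin N → (Fin 4 → ℝ) → X}
    (hl : ∀ i, ContMDiffOn 𝓘(ℝ, Fin 4 → ℝ) (𝓡∂ 4) ∞ (l i) (stdCorner 4))
    (hlm : ∀ i, Measurable (l i))
    (hfl : ∀ i, ∀ t ∈ stdCorner 4, ι (l i t) = f i t)
    (hcov : ⋃ i, l i '' stdCorner 4 = univ)
    (hinj : ∀ i, InjOn (l i) (interior (stdCorner 4)))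
    (hdisj : ∀ i j, i ≠ j → Disjoint (l i '' interior (stdCorner 4))
      (l j '' interior (stdCorner 4))) :
    volumeMeasure Φ ι univ =
      ∑ i, ∫⁻ t in interior (stdCorner 4), ENNReal.ofReal (Φ.jacobian (f i) t) := by
  set ν : Measure X := ∑ i, ((volume.restrict (interior (stdCorner 4))).withDensity
    fun t => ENNReal.ofReal (Φ.jacobian (f i) t)).map (l i) with hν
  have hνA : ∀ A, MeasurableSet A → ν A =
      ∑ i, ∫⁻ t in interior (stdCorner 4) ∩ l i ⁻¹' A, ENNReal.ofReal (Φ.jacobian (f i) t) := by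
    intro A hA
    rw [hν, Measure.finsetSum_apply]
    refine Finset.sum_congr rfl fun i _ => ?_
    rw [Measure.map_apply (hlm i) hA, withDensity_apply _ (hlm i hA),
      Measure.restrict_restrict (hlm i hA), inter_comm]
  have hsrc : ∀ y₀ : X, MeasurableSet (extChartAt (𝓡∂ 4) y₀).source := fun y₀ =>
    (isOpen_extChartAt_source y₀).measurableSet
  have hchart : ∀ y₀ : X, chartVolume Φ ι y₀ = ν.restrict (extChartAt (𝓡∂ 4) y₀).source := by
    intro y₀
    ext A hA
    have h1 : chartVolume Φ ι y₀ A =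
        chartVolume Φ ι y₀ (A ∩ (extChartAt (𝓡∂ 4) y₀).source) := by
      rw [chartVolume_apply Φ y₀ hA, chartVolume_apply Φ y₀ (hA.inter (hsrc y₀)), inter_assoc,
        inter_self]
    rw [h1, Measure.restrict_apply hA, hνA _ (hA.inter (hsrc y₀)),
      chartVolume_apply_eq_sum Φ hι hl hlm hfl hcov hinj hdisj y₀ (hA.inter (hsrc y₀))
        inter_subset_right]
  have hsup : volumeMeasure Φ ι = ⨆ y₀, chartVolume Φ ι y₀ := rfl
  have hle : volumeMeasure Φ ι ≤ ν := by
    rw [hsup]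
    exact iSup_le fun y₀ => (hchart y₀).trans_le Measure.restrict_le_self
  have heq : volumeMeasure Φ ι = ν := by
    obtain ⟨T, hT, hTcov⟩ := TopologicalSpace.countable_cover_nhds
      fun y : X => extChartAt_source_mem_nhds (I := 𝓡∂ 4) y
    refine (Measure.ext_iff_of_biUnion_eq_univ hT hTcov).2 fun y _ => le_antisymm
      (Measure.restrict_mono subset_rfl hle) ?_
    calc ν.restrict (extChartAt (𝓡∂ 4) y).source
        = (chartVolume Φ ι y).restrict (extChartAt (𝓡∂ 4) y).source := by
          rw [hchart y, Measure.restrict_restrict (hsrc y), inter_self]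
      _ ≤ _ := Measure.restrict_mono subset_rfl (hsup ▸ le_iSup (chartVolume Φ ι) y)
  rw [heq, hνA _ MeasurableSet.univ]
  simp only [preimage_univ, inter_univ]

end ChartVolume

/-! ### Integrals and volumes of simplices -/

section Simplex

variable {M : Type*} [TopologicalSpace M] [ChartedSpace (EuclideanSpace ℝ (Fin 8)) M]
  (Φ : Spin7Structure M) (σ : SmoothSimplex M 4)

theorem SmoothSimplex.abs_density_le (t : Fin 4 → ℝ) :
    |σ.density Φ t| ≤ Φ.jacobian σ.extend t :=
  Φ.abs_form_le_gramVolume _ _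

/-- The volume of a simplex. -/
noncomputable def SmoothSimplex.volume : ℝ :=
  ∫ t in interior (stdCorner 4), Φ.jacobian σ.extend t

theorem SmoothSimplex.volume_nonneg : 0 ≤ σ.volume Φ :=
  integral_nonneg fun _ => Φ.gramVolume_nonneg _ _

theorem mul_le_of_abs_le_of_unit {a b : ℝ} (h : |a| ≤ b) (ε : ℤˣ) : ((ε : ℤ) : ℝ) * a ≤ b := by
  rcases Int.units_eq_one_or ε with rfl | rfl
  · simpa using (abs_le.1 h).2
  · simpa using neg_le.1 (abs_le.1 h).1

variable [IsManifold (𝓡 8) ∞ M]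

theorem SmoothSimplex.continuousOn_density :
    ContinuousOn (σ.density Φ) (interior (stdCorner 4)) := fun _ ht =>
  (Φ.contDiffAt_pullback_apply isOpen_interior (σ.contMDiffOn_extend.mono interior_subset) ht
    _).continuousAt.continuousWithinAt

theorem SmoothSimplex.continuousOn_jacobian :
    ContinuousOn (Φ.jacobian σ.extend) (interior (stdCorner 4)) :=
  Φ.continuousOn_jacobian isOpen_interior (σ.contMDiffOn_extend.mono interior_subset)

theorem SmoothSimplex.integrableOn_jacobian :
    IntegrableOn (Φ.jacobian σ.extend) (interior (stdCorner 4)) := by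
  obtain ⟨U, hU, hΔ, f, hf, hfσ⟩ := σ.smooth'
  refine (((Φ.continuousOn_jacobian hU hf).mono hΔ).integrableOn_compact
    (isCompact_stdCorner 4)).mono_set interior_subset |>.congr_fun (fun t ht => ?_)
    isOpen_interior.measurableSet
  exact (Φ.jacobian_congr (σ.extend_eventuallyEq hfσ ht)).symm

theorem SmoothSimplex.integrableOn_density :
    IntegrableOn (σ.density Φ) (interior (stdCorner 4)) :=
  (σ.integrableOn_jacobian Φ).mono'
    ((σ.continuousOn_density Φ).aestronglyMeasurable isOpen_interior.measurableSet)
    (Filter.Eventually.of_forall fun t => σ.abs_density_le Φ t)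

theorem SmoothSimplex.mul_integral_le_volume (ε : ℤˣ) :
    ((ε : ℤ) : ℝ) * σ.integral Φ ≤ σ.volume Φ := by
  rw [SmoothSimplex.integral, ← integral_const_mul]
  exact setIntegral_mono_on ((σ.integrableOn_density Φ).const_mul _) (σ.integrableOn_jacobian Φ)
    isOpen_interior.measurableSet fun t _ => mul_le_of_abs_le_of_unit (σ.abs_density_le Φ t) ε

/-- Equality in the integrated Cayley inequality forces pointwise equality, by continuity. -/
theorem SmoothSimplex.mul_integral_eq_volume_iff (ε : ℤˣ) :
    ((ε : ℤ) : ℝ) * σ.integral Φ = σ.volume Φ ↔ ∀ t ∈ interior (stdCorner 4),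
      ((ε : ℤ) : ℝ) * σ.density Φ t = Φ.jacobian σ.extend t := by
  rw [SmoothSimplex.integral, ← integral_const_mul]
  constructor
  · intro h
    have hi := (σ.integrableOn_density Φ).const_mul ((ε : ℤ) : ℝ)
    have h0 : ∫ t in interior (stdCorner 4),
        (Φ.jacobian σ.extend t - ((ε : ℤ) : ℝ) * σ.density Φ t) = 0 := by
      rw [integral_sub (σ.integrableOn_jacobian Φ) hi, h]
      exact sub_self _
    rw [setIntegral_eq_zero_iff_of_nonneg_ae (Filter.Eventually.of_forall fun t =>
      sub_nonneg.2 (mul_le_of_abs_le_of_unit (σ.abs_density_le Φ t) ε))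
      ((σ.integrableOn_jacobian Φ).sub hi)] at h0
    intro t ht
    have := Measure.eqOn_open_of_ae_eq h0 isOpen_interior
      ((σ.continuousOn_jacobian Φ).sub (continuousOn_const.mul (σ.continuousOn_density Φ)))
      continuousOn_const ht
    exact (sub_eq_zero.1 this).symm
  · exact fun h => setIntegral_congr_fun isOpen_interior.measurableSet h

end Simplex

section Fundamental

variable {M : Type*} [TopologicalSpace M] [ChartedSpace (EuclideanSpace ℝ (Fin 8)) M]
  {N : ℕ} {σ : Fin N → SmoothSimplex M 4}

theorem chainIntegral_sum_single (Φ : Spin7Structure M) (ε : Fin N → ℤˣ) :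
    chainIntegral Φ (∑ i, Finsupp.single (σ i) (ε i : ℤ)) =
      ∑ i, ((ε i : ℤ) : ℝ) * (σ i).integral Φ := by
  simp [chainIntegral_single]

theorem iUnion_image_lift_eq_univ {X : Type*} {ι : X → M} (hι : Function.Injective ι)
    (hcov : ⋃ i, range (σ i).toFun = range ι) {l : Fin N → (Fin 4 → ℝ) → X}
    (hl : ∀ i, ∀ t ∈ stdCorner 4, ι (l i t) = (σ i).extend t) :
    ⋃ i, l i '' stdCorner 4 = univ := by
  refine eq_univ_of_forall fun y => ?_
  obtain ⟨i, t, ht⟩ := mem_iUnion.1 (hcov.symm ▸ mem_range_self y : ι y ∈ ⋃ i, range (σ i).toFun)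
  refine mem_iUnion.2 ⟨i, t, t.2, hι ?_⟩
  rw [hl i t t.2, (σ i).extend_of_mem t.2, ht]

variable {X : Type*} [TopologicalSpace X] [ChartedSpace (EuclideanHalfSpace 4) X] {ι : X → M}

open scoped Classical in
theorem SmoothSimplex.exists_measurable_lift [MeasurableSpace X] [BorelSpace X]
    (hι : Manifold.IsSmoothEmbedding (𝓡∂ 4) (𝓡 8) ∞ ι) (σ : SmoothSimplex M 4)
    (h : range σ.toFun ⊆ range ι) :
    ∃ l : (Fin 4 → ℝ) → X, Measurable l ∧
      ContMDiffOn 𝓘(ℝ, Fin 4 → ℝ) (𝓡∂ 4) ∞ l (stdCorner 4) ∧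
      ∀ t ∈ stdCorner 4, ι (l t) = σ.extend t := by
  obtain ⟨l, hl⟩ := σ.exists_lift h
  have hl' : ∀ t ∈ stdCorner 4, ι ((stdCorner 4).piecewise l (fun _ => l 0) t) = σ.extend t :=
    fun t ht => by rw [piecewise_eq_of_mem _ _ _ ht, hl t ht]
  exact ⟨_, (σ.contMDiffOn_lift hι hl).continuousOn.measurable_piecewise continuousOn_const
    (isClosed_stdCorner 4).measurableSet, σ.contMDiffOn_lift hι hl', hl'⟩

variable [IsManifold (𝓡 8) ∞ M] (Φ : Spin7Structure M) [IsManifold (𝓡∂ 4) ∞ X]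

/-- The volume of a submanifold, for simplices that cover it with embedded disjoint interiors. -/
theorem vol_eq_sum_volume (hι : Manifold.IsSmoothEmbedding (𝓡∂ 4) (𝓡 8) ∞ ι)
    [SecondCountableTopology M]
    (hcov : ⋃ i, range (σ i).toFun = range ι)
    (hinj : ∀ i, InjOn (σ i).extend (interior (stdCorner 4)))
    (hdisj : ∀ i j, i ≠ j → Disjoint ((σ i).extend '' interior (stdCorner 4))
      ((σ j).extend '' interior (stdCorner 4))) :
    vol Φ ι = ENNReal.ofReal (∑ i, (σ i).volume Φ) := by
  let _ : MeasurableSpace X := borel X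
  have : BorelSpace X := ⟨rfl⟩
  have : SecondCountableTopology X := hι.isEmbedding.secondCountableTopology
  choose l hlm hl hfl using fun i => (σ i).exists_measurable_lift hι
    (hcov ▸ subset_iUnion (fun i => range (σ i).toFun) i)
  refine (volumeMeasure_univ_eq_sum Φ hι.contMDiff hl hlm hfl
    (iUnion_image_lift_eq_univ hι.isEmbedding.injective hcov hfl) ?_ ?_).trans ?_
  · intro i s hs t ht hst
    refine hinj i hs ht ?_
    rw [← hfl i s (interior_subset hs), hst, hfl i t (interior_subset ht)]
  · intro i j hij
    rw [Set.disjoint_left]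
    rintro _ ⟨s, hs, rfl⟩ ⟨t, ht, hst⟩
    refine Set.disjoint_left.1 (hdisj i j hij) ⟨s, hs, rfl⟩ ⟨t, ht, ?_⟩
    rw [← hfl i s (interior_subset hs), ← hst, hfl j t (interior_subset ht)]
  · rw [ENNReal.ofReal_sum_of_nonneg fun i _ => (σ i).volume_nonneg Φ]
    refine Finset.sum_congr rfl fun i _ => ?_
    rw [SmoothSimplex.volume, ofReal_integral_eq_lintegral_ofReal ((σ i).integrableOn_jacobian Φ)
      (Filter.Eventually.of_forall fun t => Φ.gramVolume_nonneg _ _)]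

/-- The interiors of the simplices are dense: their complement has measure zero in charts. -/
theorem dense_iUnion_image_interior {l : Fin N → (Fin 4 → ℝ) → X}
    (hl : ∀ i, ContMDiffOn 𝓘(ℝ, Fin 4 → ℝ) (𝓡∂ 4) ∞ (l i) (stdCorner 4))
    (hcov : ⋃ i, l i '' stdCorner 4 = univ) :
    Dense (⋃ i, l i '' interior (stdCorner 4)) := by
  rw [dense_iff_inter_open]
  rintro O hO ⟨y, hy⟩
  by_contra hemp
  rw [Set.not_nonempty_iff_eq_empty, ← Set.disjoint_iff_inter_eq_empty] at hemp
  set φ := extChartAt (𝓡∂ 4) y with hφ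
  -- the chart image of `O` contains a nonempty open subset of the half space
  have hnhds : φ.symm ⁻¹' O ∩ φ.target ∈ 𝓝[range (𝓡∂ 4)] φ y :=
    Filter.inter_mem (mem_nhdsWithin_of_mem_nhds
      ((continuousAt_extChartAt_symm y).preimage_mem_nhds
        (by rw [extChartAt_to_inv]; exact hO.mem_nhds hy)))
      (extChartAt_target_mem_nhdsWithin y)
  obtain ⟨P, hP, hyP, hPsub⟩ := mem_nhdsWithin.1 hnhds
  have hyr : φ y ∈ closure (interior (range (𝓡∂ 4))) :=
    (𝓡∂ 4).range_subset_closure_interior (mem_range_self _)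
  have hQ : (P ∩ interior (range (𝓡∂ 4))).Nonempty := mem_closure_iff.1 hyr P hP hyP
  have hQo : IsOpen (WithLp.ofLp '' (P ∩ interior (range (𝓡∂ 4))) : Set (Fin 4 → ℝ)) :=
    (PiLp.homeomorph 2 fun _ : Fin 4 => ℝ).isOpenMap _ (hP.inter isOpen_interior)
  refine (hQo.measure_pos volume (hQ.image _)).ne' ?_
  refine measure_mono_null ?_ (measure_iUnion_null fun i =>
      volume_coordMap_image_eq_zero (hl i) y)
  rintro _ ⟨u, hu, rfl⟩
  obtain ⟨huO, hut⟩ := hPsub ⟨hu.1, interior_subset hu.2⟩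
  obtain ⟨i, t, ht, htu⟩ := mem_iUnion.1
    (hcov.symm ▸ mem_univ (φ.symm u) : φ.symm u ∈ ⋃ i, l i '' stdCorner 4)
  refine mem_iUnion.2 ⟨i, t, ⟨⟨ht, fun hti => ?_⟩, ?_⟩, ?_⟩
  · exact Set.disjoint_left.1 hemp huO (mem_iUnion.2 ⟨i, t, hti, htu⟩)
  · rw [mem_preimage, htu]
    exact φ.map_target hut
  · rw [coordMap, htu, ← hφ, φ.right_inv hut]

end Fundamental

/-! ### The calibration argument -/

section Calibration

variable {M : Type*} [TopologicalSpace M] [ChartedSpace (EuclideanSpace ℝ (Fin 8)) M]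
  {X : Type*} [TopologicalSpace X] [ChartedSpace (EuclideanHalfSpace 4) X] {ι : X → M}

/-- The Cayley condition at a point for one positively oriented basis implies it for all. -/
theorem form_eq_gramVolume_of_orientation_eq (Φ : Spin7Structure M) {y : X}
    {b₀ b : Basis (Fin 4) ℝ (TangentSpace (𝓡∂ 4) y)} (hb : b.orientation = b₀.orientation)
    (h : Φ.form (ι y) (fun k => mfderiv (𝓡∂ 4) (𝓡 8) ι y (b₀ k)) =
      Φ.gramVolume (ι y) (fun k => mfderiv (𝓡∂ 4) (𝓡 8) ι y (b₀ k))) :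
    Φ.form (ι y) (fun k => mfderiv (𝓡∂ 4) (𝓡 8) ι y (b k)) =
      Φ.gramVolume (ι y) (fun k => mfderiv (𝓡∂ 4) (𝓡 8) ι y (b k)) :=
  (Φ.form_eq_gramVolume_of_basis (ι y) (mfderiv (𝓡∂ 4) (𝓡 8) ι y).toLinearMap hb 1
    (if_pos rfl).symm).2 (by simpa using h)

variable [IsManifold (𝓡∂ 4) ∞ X]

/-- At an interior point of a simplex that cuts out a piece of `X`, with sign `ε`, the Cayley
condition is the equality of the density of `ε Φ` with the volume density. -/
theorem isCayley_basis_iff (Φ : Spin7Structure M) {o : ManifoldOrientation X} {y : X}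
    {σ : SmoothSimplex M 4} {t : Fin 4 → ℝ} (hy : ι y = σ.extend t) {ε : ℤˣ}
    {b₀ : Basis (Fin 4) ℝ (TangentSpace (𝓡∂ 4) y)}
    (hb₀ : ∀ k, mfderiv (𝓡∂ 4) (𝓡 8) ι y (b₀ k) =
      mfderiv 𝓘(ℝ, Fin 4 → ℝ) (𝓡 8) σ.extend t (Pi.single k (1 : ℝ) : Fin 4 → ℝ))
    (hε : b₀.orientation = if ε = 1 then o.at' y else -o.at' y)
    {b : Basis (Fin 4) ℝ (TangentSpace (𝓡∂ 4) y)} (hb : b.orientation = o.at' y) :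
    Φ.form (ι y) (fun k => mfderiv (𝓡∂ 4) (𝓡 8) ι y (b k)) =
        Φ.gramVolume (ι y) (fun k => mfderiv (𝓡∂ 4) (𝓡 8) ι y (b k)) ↔
      ((ε : ℤ) : ℝ) * σ.density Φ t = Φ.jacobian σ.extend t := by
  refine (Φ.form_eq_gramVolume_of_basis (ι y) (mfderiv (𝓡∂ 4) (𝓡 8) ι y).toLinearMap hb ε hε
    ).trans ?_
  have h1 : Φ.form (ι y) (fun k => mfderiv (𝓡∂ 4) (𝓡 8) ι y (b₀ k)) = σ.density Φ t :=
    Φ.form_congr hy hb₀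
  have h2 : Φ.gramVolume (ι y) (fun k => mfderiv (𝓡∂ 4) (𝓡 8) ι y (b₀ k)) =
      Φ.jacobian σ.extend t := Φ.gramVolume_congr hy hb₀
  rw [← h1, ← h2]
  rfl

variable [IsManifold (𝓡 8) ∞ M]

/-- The Cayley condition is closed: it is enough to check it on a dense set. -/
theorem isCayley_of_dense (Φ : Spin7Structure M) (hι : ContMDiff (𝓡∂ 4) (𝓡 8) ∞ ι)
    {o : ManifoldOrientation X} {D : Set X} (hD : Dense D)
    (h : ∀ y ∈ D, ∀ b : Basis (Fin 4) ℝ (TangentSpace (𝓡∂ 4) y), b.orientation = o.at' y →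
      Φ.form (ι y) (fun k => mfderiv (𝓡∂ 4) (𝓡 8) ι y (b k)) =
        Φ.gramVolume (ι y) (fun k => mfderiv (𝓡∂ 4) (𝓡 8) ι y (b k))) :
    IsCayley Φ ι o := by
  have : IsManifold (𝓡 8) 1 M := IsManifold.of_le (n := ∞) (by simp)
  have : IsManifold (𝓡∂ 4) 1 X := IsManifold.of_le (n := ∞) (by simp)
  intro y₀ b hb
  obtain ⟨U, hU, s, hs, hsb⟩ := o.continuous' y₀
  have hcont : ∀ k, ContinuousWithinAt (fun y => (⟨ι y, mfderiv (𝓡∂ 4) (𝓡 8) ι y (s k y)⟩ :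
      TangentBundle (𝓡 8) M)) U y₀ := fun k =>
    ((hι.continuous_tangentMap (by simp)).comp_continuousOn (hs k)) y₀ (mem_of_mem_nhds hU)
  have h1 := (Φ.continuousWithinAt_form hcont).continuousAt hU
  have h2 := (Φ.continuousWithinAt_gramVolume hcont).continuousAt hU
  have hfreq : ∃ᶠ y in 𝓝 y₀, Φ.form (ι y) (fun k => mfderiv (𝓡∂ 4) (𝓡 8) ι y (s k y)) =
      Φ.gramVolume (ι y) (fun k => mfderiv (𝓡∂ 4) (𝓡 8) ι y (s k y)) := by
    refine ((mem_closure_iff_frequently.1 (hD y₀)).and_eventually hU).mono fun y hy => ?_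
    obtain ⟨b', hb', hob'⟩ := hsb y hy.2
    have := h y hy.1 b' hob'
    simpa only [hb'] using this
  have heq := tendsto_nhds_unique_of_frequently_eq h1 h2 hfreq
  obtain ⟨b', hb', hob'⟩ := hsb y₀ (mem_of_mem_nhds hU)
  refine form_eq_gramVolume_of_orientation_eq Φ (b₀ := b') (hb.trans hob'.symm) ?_
  simpa only [hb'] using heq

/-- The Cayley inequality for a compact oriented submanifold and a chain that represents its
fundamental class, with its equality case. -/
theorem IsFundamentalChain.exists_vol_eq [SecondCountableTopology M] (Φ : Spin7Structure M)
    (hι : Manifold.IsSmoothEmbedding (𝓡∂ 4) (𝓡 8) ∞ ι) {o : ManifoldOrientation X}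
    {c : Chain M 4} (hc : IsFundamentalChain ι o c) :
    ∃ V : ℝ, 0 ≤ V ∧ vol Φ ι = ENNReal.ofReal V ∧ chainIntegral Φ c ≤ V ∧
      (chainIntegral Φ c = V ↔ IsCayley Φ ι o) := by
  obtain ⟨N, σ, ε, rfl, hcov, hinj, hdisj, hfr, -⟩ := hc
  have hle : ∀ i ∈ Finset.univ, ((ε i : ℤ) : ℝ) * (σ i).integral Φ ≤ (σ i).volume Φ :=
    fun i _ => (σ i).mul_integral_le_volume Φ (ε i)
  refine ⟨∑ i, (σ i).volume Φ, Finset.sum_nonneg fun i _ => (σ i).volume_nonneg Φ,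
    vol_eq_sum_volume Φ hι hcov hinj hdisj, ?_, ?_⟩
  · rw [chainIntegral_sum_single]
    exact Finset.sum_le_sum hle
  rw [chainIntegral_sum_single, Finset.sum_eq_sum_iff_of_le hle]
  simp only [Finset.mem_univ, true_implies, SmoothSimplex.mul_integral_eq_volume_iff]
  constructor
  · intro h
    choose l hl using fun i => (σ i).exists_lift
      (hcov ▸ subset_iUnion (fun i => range (σ i).toFun) i)
    refine isCayley_of_dense Φ hι.contMDiff (dense_iUnion_image_interior
      (fun i => (σ i).contMDiffOn_lift hι (hl i))
      (iUnion_image_lift_eq_univ hι.isEmbedding.injective hcov hl)) ?_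
    rintro y hy b hb
    obtain ⟨i, t, ht, rfl⟩ := mem_iUnion.1 hy
    obtain ⟨y, hy, b₀, hb₀, hε⟩ := hfr i t ht
    obtain rfl : y = l i t :=
      hι.isEmbedding.injective (hy.trans (hl i t (interior_subset ht)).symm)
    exact (isCayley_basis_iff Φ hy hb₀ hε hb).2 (h i t ht)
  · intro h i t ht
    obtain ⟨y, hy, b₀, hb₀, hε⟩ := hfr i t ht
    have hb := b₀.orientation_adjustToOrientation (o.at' y)
    exact (isCayley_basis_iff Φ hy hb₀ hε hb).1 (h y _ hb)

end Calibration

end CayleyGeometry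

theorem mainTheorem8
    -- the `8`-manifold `M` with a torsion-free `Spin(7)`-structure
    {M : Type*} [TopologicalSpace M] [T2Space M] [SecondCountableTopology M]
    [ChartedSpace (EuclideanSpace ℝ (Fin 8)) M] [IsManifold (𝓡 8) ∞ M]
    (Φ : Spin7Structure M) (hΦ : Φ.IsTorsionFree)
    -- the compact submanifold `X` with boundary, Cayley with respect to the orientation `oX`
    {X : Type*} [TopologicalSpace X] [ChartedSpace (EuclideanHalfSpace 4) X]
    [IsManifold (𝓡∂ 4) ∞ X] [CompactSpace X]
    (ι : X → M) (hι : Manifold.IsSmoothEmbedding (𝓡∂ 4) (𝓡 8) ∞ ι)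
    (oX : ManifoldOrientation X) (hX : IsCayley Φ ι oX)
    -- the `4`-dimensional submanifold `W` with `Φ|_W = 0`
    {W : Type*} [TopologicalSpace W] [ChartedSpace (EuclideanSpace ℝ (Fin 4)) W]
    [IsManifold (𝓡 4) ∞ W]
    (j : W → M) (hj : Manifold.IsSmoothEmbedding (𝓡 4) (𝓡 8) ∞ j)
    (hW : ∀ (w : W) (v : Fin 4 → TangentSpace (𝓡 4) w),
      Φ.form (j w) (fun k => mfderiv (𝓡 4) (𝓡 8) j w (v k)) = 0)
    (hXW : ι '' (𝓡∂ 4).boundary X ⊆ range j)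
    -- the compact oriented submanifold `Y` with boundary on `W`
    {Y : Type*} [TopologicalSpace Y] [ChartedSpace (EuclideanHalfSpace 4) Y]
    [IsManifold (𝓡∂ 4) ∞ Y] [CompactSpace Y]
    (κ : Y → M) (hκ : Manifold.IsSmoothEmbedding (𝓡∂ 4) (𝓡 8) ∞ κ)
    (oY : ManifoldOrientation Y)
    (hYW : κ '' (𝓡∂ 4).boundary Y ⊆ range j)
    (hXY : SameRelHomologyClass (range j) ι oX κ oY) :
    vol Φ ι ≤ vol Φ κ ∧ (vol Φ κ = vol Φ ι ↔ IsCayley Φ κ oY) := by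
  obtain ⟨c, c', hc, hc', hcc'⟩ := hXY
  obtain ⟨V, hV, hvX, -, hVX⟩ := hc.exists_vol_eq Φ hι
  obtain ⟨V', hV', hvY, hleY, hVY⟩ := hc'.exists_vol_eq Φ hκ
  have hI := chainIntegral_eq_of_relClass_eq hΦ hj hW hcc'
  have hVc : V = chainIntegral Φ c' := (hVX.2 hX).symm.trans hI
  rw [hvX, hvY, ENNReal.ofReal_eq_ofReal_iff hV' hV, ← hVY, hVc, eq_comm]
  exact ⟨ENNReal.ofReal_le_ofReal hleY, Iff.rfl⟩
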